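/- Let $0<L_1\le L_2$, $L=L_1+L_2$, and suppose that $L_1/L$ is irrational. For either sign, consider the problem of finding the pairs $(\omega,u)$ with $$(P_\pm)\qquad -u''-u^3=\omega u \ \text{ on } [0,L],\quad u\in H^2_{\mathrm{per}}([0,L]),\quad \omega<0,\quad u(0)=\pm u(L_1)=\sqrt{2|\omega|},$$ where $H^2_{\mathrm{per}}([0,L])=\{u\in H^2([0,L]): u(0)=u(L),\ u'(0)=u'(L)\}$ and $u$ is real-valued. Let $[\cdot]$ be the floor function, let $\operatorname{cn}(\cdot\,;k)$ be the Jacobi cnoidal function with modulus $k$, let $K(k)=\int_0^1\frac{dt}{\sqrt{(1-t^2)(1-k^2t^2)}}$, and for $k\in(1/\sqrt2,1)$ put $$S(k)=4\sqrt{2k^2-1}\,K(k),\qquad \varphi(k)=\frac1{K(k)}\int_{\sqrt{(2k^2-1)/k^2}}^1\frac{dt}{\sqrt{(1-t^2)\,(1-k^2(1-t^2))}} .$$ Then $S:(1/\sqrt2,1)\to(0,\infty)$ and $\varphi:(1/\sqrt2,1)\to(0,1)$ are bijections; let $G=S\circ\varphi^{-1}:(0,1)\to(0,\infty)$. For $n\ge1$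 put $r_n=\frac{L_1}{L}n-\left[\frac{L_1}{L}n+\frac12\right]$ and $\xi_n=2|r_n|$; then $\xi_n\in(0,1)$. Let $\omega_n^\pm<0$ be the unique negative solutions of $$\sqrt{|\omega_n^+|}=\frac nL\,G(\xi_n),\qquad \sqrt{|\omega_n^-|}=\frac nL\,G(1-\xi_n).$$ The set of all the solutions of $(P_\pm)$ is countable and infinite, and it is exactly $\{(\omega_n^\pm,u_n^\pm): n\ge1\}$, where $u_n^\pm$ is (the restriction to $[0,L]$ of) $$u_n^\pm(x)=\sqrt{\frac{2|\omega_n^\pm|k_n^2}{2k_n^2-1}}\ \operatorname{cn}\!\left(\sqrt{\frac{|\omega_n^\pm|}{2k_n^2-1}}\,(x-s_n^\pm);k_n\right),\qquad k_n=S^{-1}\!\left(L\frac{\sqrt{|\omega_n^\pm|}}{n}\right),$$ $$s_n^+=\frac{L}{2n}\,r_n,\qquad s_n^-=\frac{L}{2n}\left(|r_n|-\frac12\right)\operatorname{sgn}(r_n).$$ As a function on $\mathbb R$, $u_n^\pm$ has minimal period $L/n$. -/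

import Mathlib

open MeasureTheory Set


namespace DoubleBridge

noncomputable section

/-! ### Elliptic functions -/

/-- The complete elliptic integral of the first kind, with modulus `k`. -/
def ellipticK (k : ℝ) : ℝ :=
  ∫ t in (0 : ℝ)..1, 1 / Real.sqrt ((1 - t ^ 2) * (1 - k ^ 2 * t ^ 2))

/-- The incomplete elliptic integral of the first kind, as a function of the angle. -/
def ellipticF (k a : ℝ) : ℝ :=
  ∫ θ in (0 : ℝ)..a, 1 / Real.sqrt (1 - k ^ 2 * Real.sin θ ^ 2)

/-- The Jacobi amplitude `am(x; k)`, for `0 ≤ k < 1`: the inverse of the increasing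
bijection `ellipticF k` of the real line. -/
def jacobiAm (x k : ℝ) : ℝ :=
  Function.invFun (ellipticF k) x

/-- The Jacobi cnoidal function `cn(x; k)` with modulus `k`. -/
def jacobiCn (x k : ℝ) : ℝ :=
  Real.cos (jacobiAm x k)

/-- The interval `(1/√2, 1)` of admissible moduli. -/
def moduli : Set ℝ :=
  Ioo (1 / Real.sqrt 2) 1

/-- `S(k) = 4 √(2k² - 1) K(k)`, considered for `k ∈ (1/√2, 1)`. -/
def S (k : ℝ) : ℝ :=
  4 * Real.sqrt (2 * k ^ 2 - 1) * ellipticK k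

/-- The inverse of `S : (1/√2, 1) → (0, ∞)`. -/
def SInv (y : ℝ) : ℝ :=
  Function.invFunOn S moduli y

/-- The quotient of elliptic integrals `φ(k)`, considered for `k ∈ (1/√2, 1)`. -/
def phi (k : ℝ) : ℝ :=
  (∫ t in (Real.sqrt ((2 * k ^ 2 - 1) / k ^ 2))..1,
      1 / Real.sqrt ((1 - t ^ 2) * (1 - k ^ 2 * (1 - t ^ 2)))) /
    ∫ t in (0 : ℝ)..1, 1 / Real.sqrt ((1 - t ^ 2) * (1 - k ^ 2 * t ^ 2))

/-- The inverse of `φ : (1/√2, 1) → (0, 1)`. -/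
def phiInv (y : ℝ) : ℝ :=
  Function.invFunOn phi moduli y

/-- `G = S ∘ φ⁻¹`, on `(0, 1)`. -/
def G (y : ℝ) : ℝ :=
  S (phiInv y)

/-! ### The boundary value problems -/

/-- `g` is the weak derivative of `f` on `(0, L)`. -/
def HasWeakDeriv (L : ℝ) (f g : ℝ → ℝ) : Prop :=
  ∀ η : ℝ → ℝ, ContDiff ℝ ((⊤ : ℕ∞) : WithTop ℕ∞) η → HasCompactSupport η → tsupport η ⊆ Ioo 0 L →
    ∫ x in Ioo 0 L, f x * deriv η x = - ∫ x in Ioo 0 L, g x * η x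

/-- `u` belongs to `H²_per([0, L])`, with first and second weak derivatives `u'` and `u''`.
As usual in one dimension, `u` and `u'` are identified with their continuous
representatives on `[0, L]`, which gives a meaning to their values at the end points. -/
structure IsH2Per (L : ℝ) (u u' u'' : ℝ → ℝ) : Prop where
  memLp : MemLp u 2 (volume.restrict (Ioo 0 L))
  memLp_fst : MemLp u' 2 (volume.restrict (Ioo 0 L))
  memLp_snd : MemLp u'' 2 (volume.restrict (Ioo 0 L))
  weak_fst : HasWeakDeriv L u u'
  weak_snd : HasWeakDeriv L u' u''
  cont : ContinuousOn u (Icc 0 L)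
  cont_fst : ContinuousOn u' (Icc 0 L)
  periodic : u 0 = u L
  periodic_fst : u' 0 = u' L

/-- The set of the solutions `(ω, u)`, with `u` a real function on `[0, L]`, of
`-u'' - u³ = ω u`, `u ∈ H²_per([0, L])`, `ω < 0`, `u(0) = ε u(L₁) = √(2|ω|)`.
The problems `(P₊)` and `(P₋)` are the cases `ε = 1` and `ε = -1`. -/
def solutionSet (ε L₁ L : ℝ) : Set (ℝ × (Icc (0 : ℝ) L → ℝ)) :=
  {p | p.1 < 0 ∧ ∃ u u' u'' : ℝ → ℝ, IsH2Per L u u' u'' ∧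
    (∀ᵐ x ∂(volume.restrict (Ioo 0 L)), - u'' x - u x ^ 3 = p.1 * u x) ∧
    u 0 = Real.sqrt (2 * |p.1|) ∧ ε * u L₁ = Real.sqrt (2 * |p.1|) ∧
    p.2 = (Icc (0 : ℝ) L).domRestrict u}

/-! ### The explicit solutions -/

/-- `r_n = (L₁/L) n - ⌊(L₁/L) n + 1/2⌋`. -/
def r (L₁ L : ℝ) (n : ℕ) : ℝ :=
  L₁ / L * n - (⌊L₁ / L * n + 1 / 2⌋ : ℤ)

/-- `ξ_n = 2 |r_n|`. -/
def xi (L₁ L : ℝ) (n : ℕ) : ℝ :=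
  2 * |r L₁ L n|

/-- The shift `s_n⁺`. -/
def sPlus (L₁ L : ℝ) (n : ℕ) : ℝ :=
  L / (2 * n) * r L₁ L n

/-- The shift `s_n⁻`. -/
def sMinus (L₁ L : ℝ) (n : ℕ) : ℝ :=
  L / (2 * n) * (|r L₁ L n| - 1 / 2) * Real.sign (r L₁ L n)

/-- The modulus `S⁻¹(L √|ω| / n)`. -/
def modulus (L ω : ℝ) (n : ℕ) : ℝ :=
  SInv (L * (Real.sqrt |ω| / n))

/-- The rescaled cnoidal function of frequency `ω` and modulus `k = S⁻¹(L √|ω| / n)`,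
translated by `s`. -/
def profile (L ω : ℝ) (n : ℕ) (s x : ℝ) : ℝ :=
  Real.sqrt (2 * |ω| * modulus L ω n ^ 2 / (2 * modulus L ω n ^ 2 - 1)) *
    jacobiCn (Real.sqrt (|ω| / (2 * modulus L ω n ^ 2 - 1)) * (x - s)) (modulus L ω n)

end

end DoubleBridge

namespace DoubleBridge

/-! With w = |ω| the equation is the oscillator u'' = w u − u³, whose energy u'²/2 − w u²/2 + u⁴/4
is conserved. The level √(2w) is exactly where the last two terms cancel, so the condition at 0
leaves the energy u'(0)²/2 ≥ 0. Energy zero is the sech profile, which is not periodic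
(`deriv_ne_zero_of_periodic`). Positive energy gives the cnoidal waves with k in (1/√2, 1), and
every datum (√(2w), p) with p ≠ 0 lies on one of them (`exists_cnWave_initial`). Weak solutions are
classical by the du Bois-Reymond lemma, so uniqueness for the Cauchy problem (`eqOn_of_cubic_ode`)
makes every solution a cnoidal wave.

Periodicity on [0, L] says that L consists of n ≥ 1 periods, that is S(k) = L√w/n. Measure phase in
periods, starting from a crest: the level √(2w) is taken at the phases ±φ(k)/4 modulo 1, and −√(2w)
half a period away (`cnWave_eq_level_iff`). The phases of 0 and L₁ differ by n L₁/L, so the two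
level conditions become congruences modulo 1. Irrationality excludes equal signs in them; opposite
signs give φ(k) = ξ_n or 1 − ξ_n and fix the shift up to a period (`level_iff_plus`,
`level_iff_minus`).

Since φ is a bijection (`bijOn_phi`), this determines k, and then S(k) = G determines ω. Distinct n
give distinct minimal periods L/n, hence infinitely many solutions. -/

/-! ### The incomplete elliptic integral F(k, ·) -/

lemma one_sub_mul_sin_sq_pos {k : ℝ} (hk : k ^ 2 < 1) (θ : ℝ) :
    0 < 1 - k ^ 2 * Real.sin θ ^ 2 := by
  nlinarith [Real.sin_sq_add_cos_sq θ, sq_nonneg (Real.cos θ), sq_nonneg k,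
    mul_nonneg (sq_nonneg k) (sq_nonneg (Real.cos θ))]

lemma sqrt_one_sub_mul_sin_sq_pos {k : ℝ} (hk : k ^ 2 < 1) (θ : ℝ) :
    0 < Real.sqrt (1 - k ^ 2 * Real.sin θ ^ 2) :=
  Real.sqrt_pos.2 (one_sub_mul_sin_sq_pos hk θ)

lemma continuous_ellipticF_integrand {k : ℝ} (hk : k ^ 2 < 1) :
    Continuous fun θ : ℝ => 1 / Real.sqrt (1 - k ^ 2 * Real.sin θ ^ 2) :=
  continuous_const.div (by fun_prop) fun θ => (sqrt_one_sub_mul_sin_sq_pos hk θ).ne'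

lemma intervalIntegrable_ellipticF_integrand {k : ℝ} (hk : k ^ 2 < 1) (a b : ℝ) :
    IntervalIntegrable (fun θ : ℝ => 1 / Real.sqrt (1 - k ^ 2 * Real.sin θ ^ 2)) volume a b :=
  (continuous_ellipticF_integrand hk).intervalIntegrable a b

lemma hasDerivAt_ellipticF {k : ℝ} (hk : k ^ 2 < 1) (a : ℝ) :
    HasDerivAt (ellipticF k) (1 / Real.sqrt (1 - k ^ 2 * Real.sin a ^ 2)) a :=
  (continuous_ellipticF_integrand hk).integral_hasStrictDerivAt 0 a |>.hasDerivAt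

lemma continuous_ellipticF {k : ℝ} (hk : k ^ 2 < 1) : Continuous (ellipticF k) :=
  continuous_iff_continuousAt.2 fun a => (hasDerivAt_ellipticF hk a).continuousAt

lemma strictMono_ellipticF {k : ℝ} (hk : k ^ 2 < 1) : StrictMono (ellipticF k) := by
  refine strictMono_of_deriv_pos fun a => ?_
  rw [(hasDerivAt_ellipticF hk a).deriv]
  exact one_div_pos.2 (sqrt_one_sub_mul_sin_sq_pos hk a)

lemma ellipticF_neg (k a : ℝ) : ellipticF k (-a) = -ellipticF k a := by
  have h := intervalIntegral.integral_comp_neg (a := 0) (b := a)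
    (fun θ : ℝ => 1 / Real.sqrt (1 - k ^ 2 * Real.sin θ ^ 2))
  simp only [Real.sin_neg, neg_sq, neg_zero] at h
  rw [ellipticF, ellipticF, h, intervalIntegral.integral_symm]

lemma ellipticF_sub {k : ℝ} (hk : k ^ 2 < 1) (a b : ℝ) :
    ellipticF k b - ellipticF k a = ∫ θ in a..b, 1 / Real.sqrt (1 - k ^ 2 * Real.sin θ ^ 2) :=
  intervalIntegral.integral_interval_sub_left (intervalIntegrable_ellipticF_integrand hk _ _)
    (intervalIntegrable_ellipticF_integrand hk _ _)

/-- The integrand has period π, so its integral over any period is the one over [−π/2, π/2], which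
is 2F(π/2) because F is odd. -/
lemma ellipticF_add_pi {k : ℝ} (hk : k ^ 2 < 1) (a : ℝ) :
    ellipticF k (a + Real.pi) = ellipticF k a + 2 * ellipticF k (Real.pi / 2) := by
  have hper : Function.Periodic
      (fun θ : ℝ => 1 / Real.sqrt (1 - k ^ 2 * Real.sin θ ^ 2)) Real.pi := fun θ => by
    simp [Real.sin_add_pi]
  have h₁ := hper.intervalIntegral_add_eq a (-(Real.pi / 2))
  rw [← ellipticF_sub hk, ← ellipticF_sub hk,
    show -(Real.pi / 2) + Real.pi = Real.pi / 2 by ring, ellipticF_neg] at h₁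
  linarith

lemma ellipticF_add_int_mul_two_pi {k : ℝ} (hk : k ^ 2 < 1) (a : ℝ) (m : ℤ) :
    ellipticF k (a + 2 * m * Real.pi) = ellipticF k a + 4 * ellipticF k (Real.pi / 2) * m := by
  have hstep : ∀ b, ellipticF k (b + 2 * Real.pi) =
      ellipticF k b + 4 * ellipticF k (Real.pi / 2) := fun b => by
    rw [show b + 2 * Real.pi = b + Real.pi + Real.pi by ring, ellipticF_add_pi hk,
      ellipticF_add_pi hk]
    ring
  induction m using Int.induction_on with
  | zero => simp
  | succ i ih =>
    have := hstep (a + 2 * (i : ℤ) * Real.pi)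
    rw [ih] at this
    push_cast at this ⊢
    rw [show a + 2 * ((i : ℝ) + 1) * Real.pi = a + 2 * i * Real.pi + 2 * Real.pi by ring, this]
    ring
  | pred i ih =>
    have := hstep (a + 2 * (-(i : ℝ) - 1) * Real.pi)
    push_cast at ih ⊢
    rw [show a + 2 * (-(i : ℝ) - 1) * Real.pi + 2 * Real.pi = a + 2 * -(i : ℝ) * Real.pi by ring,
      ih] at this
    linarith

lemma one_le_ellipticF_integrand {k : ℝ} (hk : k ^ 2 < 1) (θ : ℝ) :
    1 ≤ 1 / Real.sqrt (1 - k ^ 2 * Real.sin θ ^ 2) := by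
  rw [le_div_iff₀ (sqrt_one_sub_mul_sin_sq_pos hk θ), one_mul, Real.sqrt_le_iff]
  refine ⟨zero_le_one, ?_⟩
  nlinarith [mul_nonneg (sq_nonneg k) (sq_nonneg (Real.sin θ))]

lemma le_ellipticF {k : ℝ} (hk : k ^ 2 < 1) {a : ℝ} (ha : 0 ≤ a) : a ≤ ellipticF k a := by
  have := intervalIntegral.integral_mono_on ha (intervalIntegrable_const (c := (1 : ℝ)))
    (intervalIntegrable_ellipticF_integrand hk 0 a) fun θ _ => one_le_ellipticF_integrand hk θ
  simpa [ellipticF] using this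

lemma ellipticF_pi_div_two_pos {k : ℝ} (hk : k ^ 2 < 1) : 0 < ellipticF k (Real.pi / 2) :=
  (by positivity : 0 < Real.pi / 2).trans_le (le_ellipticF hk (by positivity))

lemma surjective_ellipticF {k : ℝ} (hk : k ^ 2 < 1) : Function.Surjective (ellipticF k) := by
  refine (continuous_ellipticF hk).surjective ?_ ?_
  · exact Filter.tendsto_atTop_mono' _ ((Filter.eventually_ge_atTop 0).mono fun a ha =>
      le_ellipticF hk ha) Filter.tendsto_id
  · refine Filter.tendsto_atBot_mono' _ ((Filter.eventually_le_atBot 0).mono fun a ha => ?_)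
      Filter.tendsto_id
    have := le_ellipticF hk (neg_nonneg.2 ha)
    rw [ellipticF_neg] at this
    exact neg_le_neg_iff.1 this

/-! ### K and φ expressed through F -/

lemma sin_image_Ioo : Real.sin '' Ioo 0 (Real.pi / 2) = Ioo 0 1 := by
  ext y
  constructor
  · rintro ⟨x, ⟨h0, h1⟩, rfl⟩
    refine ⟨Real.sin_pos_of_pos_of_lt_pi h0 (by linarith [Real.pi_pos]), ?_⟩
    rw [← Real.sin_pi_div_two]
    exact Real.sin_lt_sin_of_lt_of_le_pi_div_two (by linarith) le_rfl h1
  · rintro ⟨h0, h1⟩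
    exact ⟨Real.arcsin y, ⟨Real.arcsin_pos.2 h0, Real.arcsin_lt_pi_div_two.2 h1⟩,
      Real.sin_arcsin (by linarith) h1.le⟩

lemma cos_image_Ioo {a : ℝ} (ha : a ∈ Icc 0 Real.pi) :
    Real.cos '' Ioo 0 a = Ioo (Real.cos a) 1 := by
  ext y
  constructor
  · rintro ⟨x, ⟨h0, h1⟩, rfl⟩
    refine ⟨Real.cos_lt_cos_of_nonneg_of_le_pi h0.le ha.2 h1, ?_⟩
    rw [← Real.cos_zero]
    exact Real.cos_lt_cos_of_nonneg_of_le_pi le_rfl (h1.le.trans ha.2) h0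
  · rintro ⟨h0, h1⟩
    have hc := Real.cos_arccos ((Real.neg_one_le_cos a).trans h0.le) h1.le
    refine ⟨Real.arccos y, ⟨Real.arccos_pos.2 h1, ?_⟩, hc⟩
    by_contra! h
    have := Real.cos_le_cos_of_nonneg_of_le_pi ha.1 (Real.arccos_le_pi y) h
    linarith

/-- Substitution t = sin θ. Working on open intervals avoids the endpoint singularity, and the
change of variables formula needs no integrability. -/
lemma ellipticK_eq_ellipticF (k : ℝ) : ellipticK k = ellipticF k (Real.pi / 2) := by
  rw [ellipticK, ellipticF, intervalIntegral.integral_of_le zero_le_one,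
    intervalIntegral.integral_of_le (by positivity), integral_Ioc_eq_integral_Ioo,
    integral_Ioc_eq_integral_Ioo, ← sin_image_Ioo,
    integral_image_eq_integral_abs_deriv_smul measurableSet_Ioo
      (fun x _ => (Real.hasDerivAt_sin x).hasDerivWithinAt)
      (Real.injOn_sin.mono (Ioo_subset_Icc_self.trans
        (Icc_subset_Icc_left (by linarith [Real.pi_pos]))))]
  refine setIntegral_congr_fun measurableSet_Ioo fun x hx => ?_
  have hc : 0 < Real.cos x := Real.cos_pos_of_mem_Ioo ⟨by linarith [hx.1, Real.pi_pos], hx.2⟩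
  simp only [smul_eq_mul]
  rw [← Real.cos_sq', Real.sqrt_mul (sq_nonneg _), Real.sqrt_sq hc.le, abs_of_pos hc, ← div_div,
    ← mul_div_assoc, mul_one_div_cancel hc.ne']

lemma integral_cos_eq_ellipticF (k : ℝ) {a : ℝ} (ha : a ∈ Icc 0 Real.pi) :
    ∫ t in (Real.cos a)..1, 1 / Real.sqrt ((1 - t ^ 2) * (1 - k ^ 2 * (1 - t ^ 2))) =
      ellipticF k a := by
  rw [ellipticF, intervalIntegral.integral_of_le (Real.cos_le_one a),
    intervalIntegral.integral_of_le ha.1, integral_Ioc_eq_integral_Ioo,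
    integral_Ioc_eq_integral_Ioo, ← cos_image_Ioo ha,
    integral_image_eq_integral_abs_deriv_smul measurableSet_Ioo
      (fun x _ => (Real.hasDerivAt_cos x).hasDerivWithinAt)
      (Real.injOn_cos.mono (Ioo_subset_Icc_self.trans (Icc_subset_Icc_right ha.2)))]
  refine setIntegral_congr_fun measurableSet_Ioo fun x hx => ?_
  have hs : 0 < Real.sin x := Real.sin_pos_of_pos_of_lt_pi hx.1 (hx.2.trans_le ha.2)
  simp only [smul_eq_mul]
  rw [← Real.sin_sq, Real.sqrt_mul (sq_nonneg _), Real.sqrt_sq hs.le, abs_neg, abs_of_pos hs,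
    ← div_div, ← mul_div_assoc, mul_one_div_cancel hs.ne']

/-- The amplitude `θ ∈ [0, π/2]` with `cos² θ = (2k² - 1) / k²`. -/
noncomputable def crossingAngle (k : ℝ) : ℝ :=
  Real.arccos (Real.sqrt ((2 * k ^ 2 - 1) / k ^ 2))

lemma sq_one_div_sqrt_two : (1 / Real.sqrt 2) ^ 2 = 1 / 2 := by
  rw [div_pow, Real.sq_sqrt (by norm_num), one_pow]

lemma moduli_bounds {k : ℝ} (hk : k ∈ moduli) : 0 < k ∧ k < 1 ∧ 1 / 2 < k ^ 2 ∧ k ^ 2 < 1 := by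
  have h0 : 0 < 1 / Real.sqrt 2 := by positivity
  have hk0 : 0 < k := h0.trans hk.1
  refine ⟨hk0, hk.2, ?_, by nlinarith [hk.2]⟩
  have := sq_one_div_sqrt_two
  nlinarith [hk.1]

lemma mem_moduli {k : ℝ} (h0 : 0 ≤ k) (h1 : 1 / 2 < k ^ 2) (h2 : k ^ 2 < 1) : k ∈ moduli := by
  refine ⟨?_, by nlinarith⟩
  have := sq_one_div_sqrt_two
  exact lt_of_pow_lt_pow_left₀ 2 h0 (by linarith)

lemma cos_crossingAngle {k : ℝ} (hk : 1 / 2 ≤ k ^ 2) (hk1 : k ^ 2 < 1) :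
    Real.cos (crossingAngle k) = Real.sqrt ((2 * k ^ 2 - 1) / k ^ 2) := by
  refine Real.cos_arccos (by linarith [Real.sqrt_nonneg ((2 * k ^ 2 - 1) / k ^ 2)]) ?_
  rw [Real.sqrt_le_iff, one_pow, div_le_one (by linarith)]
  exact ⟨zero_le_one, by linarith⟩

lemma sq_cos_crossingAngle {k : ℝ} (hk : 1 / 2 ≤ k ^ 2) (hk1 : k ^ 2 < 1) :
    Real.cos (crossingAngle k) ^ 2 = (2 * k ^ 2 - 1) / k ^ 2 := by
  rw [cos_crossingAngle hk hk1, Real.sq_sqrt (div_nonneg (by linarith) (by linarith))]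

lemma sq_sin_crossingAngle {k : ℝ} (hk : 1 / 2 ≤ k ^ 2) (hk1 : k ^ 2 < 1) :
    k ^ 2 * Real.sin (crossingAngle k) ^ 2 = 1 - k ^ 2 := by
  rw [Real.sin_sq, sq_cos_crossingAngle hk hk1]
  have : k ^ 2 ≠ 0 := by linarith
  rw [mul_sub, mul_div_cancel₀ _ this]
  ring

lemma crossingAngle_mem {k : ℝ} (hk : k ∈ moduli) : crossingAngle k ∈ Ioo 0 (Real.pi / 2) := by
  obtain ⟨_, _, h1, h2⟩ := moduli_bounds hk
  refine ⟨Real.arccos_pos.2 ?_, Real.arccos_lt_pi_div_two.2 (Real.sqrt_pos.2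
    (div_pos (by linarith) (by linarith)))⟩
  rw [Real.sqrt_lt' one_pos, one_pow, div_lt_one (by linarith)]
  linarith

lemma crossingAngle_mem_Icc (k : ℝ) : crossingAngle k ∈ Icc 0 (Real.pi / 2) :=
  ⟨Real.arccos_nonneg _, Real.arccos_le_pi_div_two.2 (Real.sqrt_nonneg _)⟩

/-- The endpoint k² = 1/2 is allowed because the intermediate value argument for φ starts there. -/
lemma phi_eq {k : ℝ} (hk : 1 / 2 ≤ k ^ 2) (hk1 : k ^ 2 < 1) :
    phi k = ellipticF k (crossingAngle k) / ellipticF k (Real.pi / 2) := by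
  have h := crossingAngle_mem_Icc k
  rw [← ellipticK_eq_ellipticF, ← integral_cos_eq_ellipticF k ⟨h.1, by linarith [h.2, Real.pi_pos]⟩,
    cos_crossingAngle hk hk1]
  rfl

lemma S_eq (k : ℝ) : S k = 4 * Real.sqrt (2 * k ^ 2 - 1) * ellipticF k (Real.pi / 2) := by
  rw [S, ellipticK_eq_ellipticF]

/-! ### Bijectivity of S and φ -/

lemma continuousOn_uncurry_ellipticF :
    ContinuousOn (fun p : ℝ × ℝ => ellipticF p.1 p.2) {p | p.1 ^ 2 < 1} := by
  intro p hp
  obtain ⟨c, hpc, hc1⟩ := exists_between ((sq_lt_one_iff_abs_lt_one p.1).1 hp)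
  have hc0 : 0 ≤ c := (abs_nonneg _).trans hpc.le
  -- Replacing k by min(|k|, c) with c < 1 makes the integrand continuous everywhere without
  -- changing it for moduli near the given one.
  have hcut : ∀ k : ℝ, (min |k| c) ^ 2 < 1 := fun k => by
    have h1 : 0 ≤ min |k| c := le_min (abs_nonneg _) hc0
    have h2 : min |k| c ≤ c := min_le_right _ _
    nlinarith
  have hcont : Continuous fun q : ℝ × ℝ =>
      ∫ θ in (0 : ℝ)..q.2, 1 / Real.sqrt (1 - (min |q.1| c) ^ 2 * Real.sin θ ^ 2) := by
    refine intervalIntegral.continuous_parametric_intervalIntegral_of_continuous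
      (f := fun (q : ℝ × ℝ) θ => 1 / Real.sqrt (1 - (min |q.1| c) ^ 2 * Real.sin θ ^ 2))
      (a₀ := 0) ?_ continuous_snd
    exact continuous_const.div (by fun_prop) fun q => (sqrt_one_sub_mul_sin_sq_pos (hcut _) _).ne'
  refine (hcont.continuousAt.congr ?_).continuousWithinAt
  have hev : ∀ᶠ q : ℝ × ℝ in nhds p, |q.1| < c :=
    (continuous_abs.comp continuous_fst).continuousAt.eventually (gt_mem_nhds hpc)
  filter_upwards [hev] with q hq
  simp only [ellipticF, min_eq_left hq.le, sq_abs]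

lemma continuousOn_ellipticF_comp {θ : ℝ → ℝ} {s : Set ℝ} (hθ : ContinuousOn θ s)
    (hs : ∀ k ∈ s, k ^ 2 < 1) : ContinuousOn (fun k => ellipticF k (θ k)) s :=
  ContinuousOn.comp (g := fun p : ℝ × ℝ => ellipticF p.1 p.2) (f := fun k => (k, θ k))
    continuousOn_uncurry_ellipticF (continuousOn_id.prodMk hθ) hs

lemma continuousOn_ellipticF_pi_div_two :
    ContinuousOn (fun k => ellipticF k (Real.pi / 2)) {k | k ^ 2 < 1} :=
  continuousOn_ellipticF_comp continuousOn_const fun _ hk => hk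

lemma continuousOn_S : ContinuousOn S {k | k ^ 2 < 1} :=
  ContinuousOn.congr (ContinuousOn.mul (by fun_prop) continuousOn_ellipticF_pi_div_two)
    fun k _ => S_eq k

lemma continuousOn_crossingAngle : ContinuousOn crossingAngle {k | 1 / 2 ≤ k ^ 2} := by
  refine Real.continuous_arccos.comp_continuousOn (Real.continuous_sqrt.comp_continuousOn ?_)
  refine ContinuousOn.div (by fun_prop) (by fun_prop) fun k hk => ?_
  have : (1 : ℝ) / 2 ≤ k ^ 2 := hk
  linarith

lemma continuousOn_phi : ContinuousOn phi {k | 1 / 2 ≤ k ^ 2 ∧ k ^ 2 < 1} := by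
  refine ContinuousOn.congr (ContinuousOn.div ?_ (continuousOn_ellipticF_pi_div_two.mono
    fun k hk => hk.2) fun k hk => (ellipticF_pi_div_two_pos hk.2).ne') fun k hk => phi_eq hk.1 hk.2
  exact continuousOn_ellipticF_comp (continuousOn_crossingAngle.mono fun k hk => hk.1)
    fun k hk => hk.2

lemma ellipticF_le_ellipticF {k₁ k₂ a : ℝ} (h : k₁ ^ 2 ≤ k₂ ^ 2) (h₂ : k₂ ^ 2 < 1) (ha : 0 ≤ a) :
    ellipticF k₁ a ≤ ellipticF k₂ a := by
  refine intervalIntegral.integral_mono_on ha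
    (intervalIntegrable_ellipticF_integrand (h.trans_lt h₂) _ _)
    (intervalIntegrable_ellipticF_integrand h₂ _ _) fun θ _ => ?_
  refine one_div_le_one_div_of_le (sqrt_one_sub_mul_sin_sq_pos h₂ θ) (Real.sqrt_le_sqrt ?_)
  gcongr

lemma strictMonoOn_S : StrictMonoOn S moduli := by
  intro k₁ h₁ k₂ h₂ h
  obtain ⟨h₁0, h₁1, h₁2, h₁3⟩ := moduli_bounds h₁
  obtain ⟨h₂0, h₂1, h₂2, h₂3⟩ := moduli_bounds h₂
  have hsq : k₁ ^ 2 < k₂ ^ 2 := by gcongr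
  rw [S_eq, S_eq]
  refine mul_lt_mul ?_ (ellipticF_le_ellipticF hsq.le h₂3 (by positivity))
    (ellipticF_pi_div_two_pos h₁3) (by positivity)
  have := Real.sqrt_lt_sqrt (x := 2 * k₁ ^ 2 - 1) (y := 2 * k₂ ^ 2 - 1) (by linarith) (by linarith)
  linarith

lemma S_pos {k : ℝ} (hk : k ∈ moduli) : 0 < S k := by
  obtain ⟨h0, h1, h2, h3⟩ := moduli_bounds hk
  rw [S_eq]
  have := Real.sqrt_pos.2 (show 0 < 2 * k ^ 2 - 1 by linarith)
  have := ellipticF_pi_div_two_pos h3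
  positivity

/-- With k² = 1 − δ² the radicand is cos²θ + δ² sin²θ ≤ (π/2 − θ + δ)², since cos θ ≤ π/2 − θ. The
resulting logarithm shows that K is unbounded as k → 1. -/
lemma log_le_ellipticF_pi_div_two {k δ : ℝ} (hδ : 0 < δ) (hk : k ^ 2 = 1 - δ ^ 2) :
    Real.log ((Real.pi / 2 + δ) / δ) ≤ ellipticF k (Real.pi / 2) := by
  have hk1 : k ^ 2 < 1 := by nlinarith
  have hint : ∫ θ in (0 : ℝ)..(Real.pi / 2), 1 / (Real.pi / 2 + δ - θ) =
      Real.log ((Real.pi / 2 + δ) / δ) := by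
    rw [intervalIntegral.integral_comp_sub_left (fun x : ℝ => 1 / x) (Real.pi / 2 + δ),
      add_sub_cancel_left, sub_zero, integral_one_div_of_pos hδ (by positivity)]
  rw [← hint]
  have hpos : ∀ θ ∈ Icc (0 : ℝ) (Real.pi / 2), 0 < Real.pi / 2 + δ - θ := fun θ hθ => by
    linarith [hθ.2]
  refine intervalIntegral.integral_mono_on (by positivity) ?_
    (intervalIntegrable_ellipticF_integrand hk1 _ _) fun θ hθ => ?_
  · refine ContinuousOn.intervalIntegrable ?_
    rw [uIcc_of_le (by positivity)]
    exact ContinuousOn.div continuousOn_const (by fun_prop) fun θ hθ => (hpos θ hθ).ne'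
  · refine one_div_le_one_div_of_le (sqrt_one_sub_mul_sin_sq_pos hk1 θ)
      (Real.sqrt_le_iff.2 ⟨(hpos θ hθ).le, ?_⟩)
    have h1 : Real.cos θ ≤ Real.pi / 2 - θ := by
      rw [← Real.sin_pi_div_two_sub]
      exact Real.sin_le (by linarith [hθ.2])
    have h2 : 0 ≤ Real.cos θ := Real.cos_nonneg_of_mem_Icc ⟨by linarith [hθ.1, Real.pi_pos], hθ.2⟩
    have h3 := Real.sin_sq_add_cos_sq θ
    have h4 : Real.sin θ ^ 2 ≤ 1 := Real.sin_sq_le_one θ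
    rw [hk]
    nlinarith [mul_le_mul h1 h1 h2 (h2.trans h1), mul_nonneg (sq_nonneg δ) (sub_nonneg.2 h4),
      mul_nonneg hδ.le (h2.trans h1)]

lemma exists_lt_ellipticF_pi_div_two (M : ℝ) :
    ∃ k ∈ moduli, 3 / 4 ≤ k ^ 2 ∧ M < ellipticF k (Real.pi / 2) := by
  set δ := min (Real.exp (-M)) (1 / 2) with hδ
  have hδ0 : 0 < δ := lt_min (Real.exp_pos _) (by norm_num)
  have hδ1 : δ ≤ 1 / 2 := min_le_right _ _
  have hδ2 : δ ≤ Real.exp (-M) := min_le_left _ _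
  have hsq : Real.sqrt (1 - δ ^ 2) ^ 2 = 1 - δ ^ 2 := Real.sq_sqrt (by nlinarith)
  refine ⟨Real.sqrt (1 - δ ^ 2), mem_moduli (Real.sqrt_nonneg _) ?_ ?_, ?_,
    lt_of_lt_of_le ?_ (log_le_ellipticF_pi_div_two hδ0 hsq)⟩
  · rw [hsq]; nlinarith
  · rw [hsq]; nlinarith
  · rw [hsq]; nlinarith
  · rw [Real.lt_log_iff_exp_lt (by positivity), lt_div_iff₀ hδ0]
    calc Real.exp M * δ ≤ Real.exp M * Real.exp (-M) := by gcongr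
      _ = 1 := by rw [← Real.exp_add]; simp
      _ < Real.pi / 2 + δ := by linarith [Real.pi_gt_three]

lemma half_le_sq_of_mem_Icc {k k₁ : ℝ} (hk₁ : k₁ ∈ moduli) (hk : k ∈ Icc (1 / Real.sqrt 2) k₁) :
    1 / 2 ≤ k ^ 2 ∧ k ^ 2 < 1 := by
  have h0 : 0 < 1 / Real.sqrt 2 := by positivity
  have := sq_one_div_sqrt_two
  exact ⟨by nlinarith [hk.1], by nlinarith [hk.1, hk.2, hk₁.2]⟩

/-- S vanishes at 1/√2 and is unbounded: for k² ≥ 3/4 the factor 4√(2k² − 1) is at least 2 while K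
is as large as desired. -/
lemma bijOn_S : BijOn S moduli (Ioi 0) := by
  refine ⟨fun k hk => S_pos hk, strictMonoOn_S.injOn, fun y hy => ?_⟩
  have hy : 0 < y := hy
  obtain ⟨k₁, hk₁, hsq, hlt⟩ := exists_lt_ellipticF_pi_div_two y
  have hSk₁ : y ≤ S k₁ := by
    rw [S_eq]
    have : 1 / 2 ≤ Real.sqrt (2 * k₁ ^ 2 - 1) := Real.le_sqrt_of_sq_le (by linarith)
    nlinarith
  have hS0 : S (1 / Real.sqrt 2) = 0 := by
    rw [S, sq_one_div_sqrt_two]; norm_num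
  obtain ⟨k, hk, hkS⟩ := intermediate_value_Icc hk₁.1.le (continuousOn_S.mono fun k hk =>
    (half_le_sq_of_mem_Icc hk₁ hk).2) ⟨hS0.le.trans hy.le, hSk₁⟩
  refine ⟨k, ⟨lt_of_le_of_ne hk.1 ?_, hk.2.trans_lt hk₁.2⟩, hkS⟩
  rintro rfl
  exact hy.ne (hS0.symm.trans hkS)

lemma crossingAngle_lt {k₁ k₂ : ℝ} (h₁ : k₁ ∈ moduli) (h₂ : k₂ ∈ moduli) (h : k₁ < k₂) :
    crossingAngle k₂ < crossingAngle k₁ := by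
  obtain ⟨h₁0, h₁1, h₁2, h₁3⟩ := moduli_bounds h₁
  obtain ⟨h₂0, h₂1, h₂2, h₂3⟩ := moduli_bounds h₂
  have hsq : k₁ ^ 2 < k₂ ^ 2 := by gcongr
  refine Real.arccos_lt_arccos (by linarith [Real.sqrt_nonneg ((2 * k₁ ^ 2 - 1) / k₁ ^ 2)])
    (Real.sqrt_lt_sqrt (div_nonneg (by linarith) (by linarith)) ?_)
    (Real.sqrt_le_iff.2 ⟨zero_le_one, ?_⟩)
  · rw [div_lt_div_iff₀ (by linarith) (by linarith)]
    nlinarith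
  · rw [one_pow, div_le_one (by linarith)]
    linarith

/-- The quotient of the integrands for k₂ and k₁ increases with sin². After clearing roots the
difference of the two sides is (k₂² − k₁²)(sin² t − sin² s). -/
lemma ellipticF_integrand_mul_le {k₁ k₂ s t : ℝ} (h : k₁ ^ 2 ≤ k₂ ^ 2) (h₂ : k₂ ^ 2 < 1)
    (hst : Real.sin s ^ 2 ≤ Real.sin t ^ 2) :
    1 / Real.sqrt (1 - k₂ ^ 2 * Real.sin s ^ 2) * (1 / Real.sqrt (1 - k₁ ^ 2 * Real.sin t ^ 2)) ≤
      1 / Real.sqrt (1 - k₂ ^ 2 * Real.sin t ^ 2) *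
        (1 / Real.sqrt (1 - k₁ ^ 2 * Real.sin s ^ 2)) := by
  have h₁ := h.trans_lt h₂
  have p := one_sub_mul_sin_sq_pos h₂ t
  have q := one_sub_mul_sin_sq_pos h₁ s
  have p' := one_sub_mul_sin_sq_pos h₂ s
  rw [one_div_mul_one_div, one_div_mul_one_div, ← Real.sqrt_mul p.le, ← Real.sqrt_mul p'.le]
  refine one_div_le_one_div_of_le (Real.sqrt_pos.2 (mul_pos p q)) (Real.sqrt_le_sqrt ?_)
  nlinarith [mul_nonneg (sub_nonneg.2 h) (sub_nonneg.2 hst)]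

lemma sin_sq_le_sin_sq {s t : ℝ} (hs : 0 ≤ s) (hst : s ≤ t) (ht : t ≤ Real.pi / 2) :
    Real.sin s ^ 2 ≤ Real.sin t ^ 2 := by
  have := Real.sin_nonneg_of_nonneg_of_le_pi hs (by linarith [Real.pi_pos])
  gcongr
  exact Real.sin_le_sin_of_le_of_le_pi_div_two (by linarith [Real.pi_pos]) ht hst

/-- The quotient of the integrands for k₂ and k₁ is at most its value g₂/g₁ at a on [0, a], and at
least that on [a, π/2]. So a larger modulus moves mass of the integral towards π/2. -/
lemma ellipticF_div_antitone {k₁ k₂ a : ℝ} (h : k₁ ^ 2 ≤ k₂ ^ 2) (h₂ : k₂ ^ 2 < 1)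
    (ha : a ∈ Icc 0 (Real.pi / 2)) :
    ellipticF k₂ a / ellipticF k₂ (Real.pi / 2) ≤ ellipticF k₁ a / ellipticF k₁ (Real.pi / 2) := by
  have h₁ := h.trans_lt h₂
  rw [div_le_div_iff₀ (ellipticF_pi_div_two_pos h₂) (ellipticF_pi_div_two_pos h₁)]
  set g₁ := 1 / Real.sqrt (1 - k₁ ^ 2 * Real.sin a ^ 2) with hg₁
  set g₂ := 1 / Real.sqrt (1 - k₂ ^ 2 * Real.sin a ^ 2) with hg₂
  have hg₁0 : 0 < g₁ := one_div_pos.2 (sqrt_one_sub_mul_sin_sq_pos h₁ a)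
  have hg₂0 : 0 < g₂ := one_div_pos.2 (sqrt_one_sub_mul_sin_sq_pos h₂ a)
  have hF : ellipticF k₂ a * g₁ ≤ g₂ * ellipticF k₁ a := by
    rw [ellipticF, ellipticF, ← intervalIntegral.integral_mul_const,
      ← intervalIntegral.integral_const_mul]
    exact intervalIntegral.integral_mono_on ha.1
      ((intervalIntegrable_ellipticF_integrand h₂ _ _).mul_const _)
      ((intervalIntegrable_ellipticF_integrand h₁ _ _).const_mul _)
      fun θ hθ => ellipticF_integrand_mul_le h h₂ (sin_sq_le_sin_sq hθ.1 hθ.2 ha.2)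
  have hR : g₂ * (ellipticF k₁ (Real.pi / 2) - ellipticF k₁ a) ≤
      (ellipticF k₂ (Real.pi / 2) - ellipticF k₂ a) * g₁ := by
    rw [ellipticF_sub h₁, ellipticF_sub h₂, ← intervalIntegral.integral_mul_const,
      ← intervalIntegral.integral_const_mul]
    exact intervalIntegral.integral_mono_on ha.2
      ((intervalIntegrable_ellipticF_integrand h₁ _ _).const_mul _)
      ((intervalIntegrable_ellipticF_integrand h₂ _ _).mul_const _)
      fun θ hθ => ellipticF_integrand_mul_le h h₂ (sin_sq_le_sin_sq ha.1 hθ.1 hθ.2)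
  have hF₁ : 0 ≤ ellipticF k₁ a := ha.1.trans (le_ellipticF h₁ ha.1)
  have hR₁ : 0 ≤ ellipticF k₁ (Real.pi / 2) - ellipticF k₁ a :=
    sub_nonneg.2 ((strictMono_ellipticF h₁).monotone ha.2)
  have key : (ellipticF k₂ a * (ellipticF k₁ (Real.pi / 2) - ellipticF k₁ a)) * g₁ ≤
      (ellipticF k₁ a * (ellipticF k₂ (Real.pi / 2) - ellipticF k₂ a)) * g₁ := by
    have e₁ := mul_le_mul_of_nonneg_right hF hR₁
    have e₂ := mul_le_mul_of_nonneg_left hR hF₁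
    linarith
  linarith [le_of_mul_le_mul_right key hg₁0]

/-- Two effects add up: the crossing angle strictly decreases with k, and so, weakly, does F(k,
a)/K(k) at fixed a. -/
lemma strictAntiOn_phi : StrictAntiOn phi moduli := by
  intro k₁ h₁ k₂ h₂ h
  obtain ⟨h₁0, h₁1, h₁2, h₁3⟩ := moduli_bounds h₁
  obtain ⟨h₂0, h₂1, h₂2, h₂3⟩ := moduli_bounds h₂
  rw [phi_eq h₁2.le h₁3, phi_eq h₂2.le h₂3]
  refine lt_of_lt_of_le ?_ (ellipticF_div_antitone (by gcongr) h₂3 (crossingAngle_mem_Icc k₁))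
  exact div_lt_div_of_pos_right (strictMono_ellipticF h₂3 (crossingAngle_lt h₁ h₂ h))
    (ellipticF_pi_div_two_pos h₂3)

lemma phi_mem_Ioo {k : ℝ} (hk : k ∈ moduli) : phi k ∈ Ioo 0 1 := by
  obtain ⟨h0, h1, h2, h3⟩ := moduli_bounds hk
  have hK := ellipticF_pi_div_two_pos h3
  have ha := crossingAngle_mem hk
  rw [phi_eq h2.le h3]
  exact ⟨div_pos (ha.1.trans_le (le_ellipticF h3 ha.1.le)) hK,
    (div_lt_one hK).2 (strictMono_ellipticF h3 ha.2)⟩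

/-- Up to the crossing angle k² sin² θ ≤ 1 − k², so the radicand stays above 1/2. This bounded
numerator against the unbounded K makes φ take arbitrarily small values. -/
lemma ellipticF_crossingAngle_le {k : ℝ} (hk : k ∈ moduli) :
    ellipticF k (crossingAngle k) ≤ Real.pi := by
  obtain ⟨h0, h1, h2, h3⟩ := moduli_bounds hk
  have ha := crossingAngle_mem hk
  have hbound : ∀ θ ∈ Icc 0 (crossingAngle k),
      1 / Real.sqrt (1 - k ^ 2 * Real.sin θ ^ 2) ≤ 2 := fun θ hθ => by
    rw [div_le_iff₀ (sqrt_one_sub_mul_sin_sq_pos h3 θ)]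
    have hs := sin_sq_le_sin_sq hθ.1 hθ.2 ha.2.le
    have hc := sq_sin_crossingAngle h2.le h3
    have : 1 / 2 ≤ Real.sqrt (1 - k ^ 2 * Real.sin θ ^ 2) :=
      Real.le_sqrt_of_sq_le (by nlinarith [mul_le_mul_of_nonneg_left hs (sq_nonneg k)])
    linarith
  have := intervalIntegral.integral_mono_on ha.1.le
    (intervalIntegrable_ellipticF_integrand h3 0 (crossingAngle k))
    (intervalIntegrable_const (c := (2 : ℝ))) hbound
  rw [intervalIntegral.integral_const, smul_eq_mul] at this
  exact this.trans (by linarith [ha.2])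

lemma bijOn_phi : BijOn phi moduli (Ioo 0 1) := by
  refine ⟨fun k hk => phi_mem_Ioo hk, strictAntiOn_phi.injOn, fun y hy => ?_⟩
  obtain ⟨k₁, hk₁, hsq, hlt⟩ := exists_lt_ellipticF_pi_div_two (Real.pi / y)
  have hphik₁ : phi k₁ ≤ y := by
    rw [phi_eq (by linarith) (moduli_bounds hk₁).2.2.2,
      div_le_iff₀ (ellipticF_pi_div_two_pos (moduli_bounds hk₁).2.2.2)]
    refine (ellipticF_crossingAngle_le hk₁).trans ?_
    rw [div_lt_iff₀ hy.1] at hlt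
    linarith
  have hphi1 : phi (1 / Real.sqrt 2) = 1 := by
    have hs := sq_one_div_sqrt_two
    have : crossingAngle (1 / Real.sqrt 2) = Real.pi / 2 := by
      rw [crossingAngle, hs]; norm_num
    rw [phi_eq hs.ge (by rw [hs]; norm_num), this, div_self]
    exact (ellipticF_pi_div_two_pos (by rw [hs]; norm_num)).ne'
  obtain ⟨k, hk, hkphi⟩ := intermediate_value_Icc' hk₁.1.le (continuousOn_phi.mono fun k hk =>
    half_le_sq_of_mem_Icc hk₁ hk) ⟨hphik₁, hy.2.le.trans hphi1.ge⟩
  refine ⟨k, ⟨lt_of_le_of_ne hk.1 ?_, hk.2.trans_lt hk₁.2⟩, hkphi⟩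
  rintro rfl
  exact hy.2.ne (hkphi.symm.trans hphi1)

/-! ### The inverse functions, the amplitude and cn -/

lemma SInv_S {k : ℝ} (hk : k ∈ moduli) : SInv (S k) = k := bijOn_S.injOn.leftInvOn_invFunOn hk

lemma phiInv_mem {y : ℝ} (hy : y ∈ Ioo 0 1) : phiInv y ∈ moduli :=
  bijOn_phi.surjOn.mapsTo_invFunOn hy

lemma phi_phiInv {y : ℝ} (hy : y ∈ Ioo 0 1) : phi (phiInv y) = y :=
  bijOn_phi.surjOn.rightInvOn_invFunOn hy

lemma phiInv_phi {k : ℝ} (hk : k ∈ moduli) : phiInv (phi k) = k :=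
  bijOn_phi.injOn.leftInvOn_invFunOn hk

lemma G_pos {y : ℝ} (hy : y ∈ Ioo 0 1) : 0 < G y := S_pos (phiInv_mem hy)

lemma ellipticF_jacobiAm {k : ℝ} (hk : k ^ 2 < 1) (x : ℝ) : ellipticF k (jacobiAm x k) = x :=
  Function.rightInverse_invFun (surjective_ellipticF hk) x

lemma jacobiAm_ellipticF {k : ℝ} (hk : k ^ 2 < 1) (a : ℝ) : jacobiAm (ellipticF k a) k = a :=
  Function.leftInverse_invFun (strictMono_ellipticF hk).injective a

lemma continuous_jacobiAm {k : ℝ} (hk : k ^ 2 < 1) : Continuous fun x => jacobiAm x k := by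
  let e := (strictMono_ellipticF hk).orderIsoOfSurjective _ (surjective_ellipticF hk)
  convert e.symm.continuous using 2 with x
  refine e.injective ?_
  rw [e.apply_symm_apply]
  exact ellipticF_jacobiAm hk x

lemma hasDerivAt_jacobiAm {k : ℝ} (hk : k ^ 2 < 1) (x : ℝ) :
    HasDerivAt (fun x => jacobiAm x k)
      (Real.sqrt (1 - k ^ 2 * Real.sin (jacobiAm x k) ^ 2)) x := by
  have h := HasDerivAt.of_local_left_inverse (continuous_jacobiAm hk).continuousAt
    (hasDerivAt_ellipticF hk (jacobiAm x k))
    (one_div_pos.2 (sqrt_one_sub_mul_sin_sq_pos hk _)).ne'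
    (Filter.Eventually.of_forall (ellipticF_jacobiAm hk))
  simpa using h

/-- The derivative `-sn(x; k) dn(x; k)` of `cn(x; k)`. -/
noncomputable def jacobiCnDeriv (x k : ℝ) : ℝ :=
  -(Real.sin (jacobiAm x k) * Real.sqrt (1 - k ^ 2 * Real.sin (jacobiAm x k) ^ 2))

lemma hasDerivAt_jacobiCn {k : ℝ} (hk : k ^ 2 < 1) (x : ℝ) :
    HasDerivAt (fun x => jacobiCn x k) (jacobiCnDeriv x k) x := by
  refine (hasDerivAt_jacobiAm hk x).cos.congr_deriv ?_
  rw [jacobiCnDeriv, neg_mul]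

lemma hasDerivAt_jacobiCnDeriv {k : ℝ} (hk : k ^ 2 < 1) (x : ℝ) :
    HasDerivAt (fun x => jacobiCnDeriv x k)
      ((2 * k ^ 2 - 1) * jacobiCn x k - 2 * k ^ 2 * jacobiCn x k ^ 3) x := by
  have hsin := (hasDerivAt_jacobiAm hk x).sin
  have hpos := one_sub_mul_sin_sq_pos hk (jacobiAm x k)
  have hdn := (((hsin.pow 2).const_mul (k ^ 2)).const_sub 1).sqrt hpos.ne'
  refine (hsin.mul hdn).neg.congr_deriv ?_
  have hs := sqrt_one_sub_mul_sin_sq_pos hk (jacobiAm x k)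
  have hsq := Real.sq_sqrt hpos.le
  have hcos := Real.cos_sq' (jacobiAm x k)
  simp only [jacobiCn, Pi.pow_apply]
  set d := Real.sqrt (1 - k ^ 2 * Real.sin (jacobiAm x k) ^ 2)
  field_simp
  rw [hsq]
  rw [show Real.cos (jacobiAm x k) ^ 2 = 1 - Real.sin (jacobiAm x k) ^ 2 from hcos]
  ring

/-- The solutions 2mπ ± θ of an equation between cosines, transported by F, which turns 2π into 4K.
-/
lemma jacobiCn_eq_iff {k : ℝ} (hk : k ^ 2 < 1) (x y : ℝ) :
    jacobiCn x k = jacobiCn y k ↔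
      ∃ m : ℤ, y = 4 * ellipticF k (Real.pi / 2) * m + x ∨
        y = 4 * ellipticF k (Real.pi / 2) * m - x := by
  have hinj := (strictMono_ellipticF hk).injective
  rw [jacobiCn, jacobiCn, Real.cos_eq_cos_iff]
  refine exists_congr fun m => or_congr ?_ ?_
  · rw [← hinj.eq_iff, add_comm, ellipticF_add_int_mul_two_pi hk, ellipticF_jacobiAm hk,
      ellipticF_jacobiAm hk, add_comm]
  · rw [← hinj.eq_iff, sub_eq_neg_add, ellipticF_add_int_mul_two_pi hk, ellipticF_neg,
      ellipticF_jacobiAm hk, ellipticF_jacobiAm hk, sub_eq_neg_add]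

lemma jacobiCn_add_half_period {k : ℝ} (hk : k ^ 2 < 1) (x : ℝ) :
    jacobiCn (x + 2 * ellipticF k (Real.pi / 2)) k = -jacobiCn x k := by
  rw [jacobiCn, jacobiCn, ← Real.cos_add_pi]
  congr 1
  apply (strictMono_ellipticF hk).injective
  rw [ellipticF_add_pi hk, ellipticF_jacobiAm hk, ellipticF_jacobiAm hk]

lemma jacobiCn_add_int_mul_period {k : ℝ} (hk : k ^ 2 < 1) (x : ℝ) (m : ℤ) :
    jacobiCn (x + 4 * ellipticF k (Real.pi / 2) * m) k = jacobiCn x k :=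
  ((jacobiCn_eq_iff hk _ _).2 ⟨m, Or.inl (add_comm _ _)⟩).symm

lemma jacobiCnDeriv_add_int_mul_period {k : ℝ} (hk : k ^ 2 < 1) (x : ℝ) (m : ℤ) :
    jacobiCnDeriv (x + 4 * ellipticF k (Real.pi / 2) * m) k = jacobiCnDeriv x k := by
  have h : (fun y => jacobiCn (y + 4 * ellipticF k (Real.pi / 2) * m) k) =
      fun y => jacobiCn y k := funext fun y => jacobiCn_add_int_mul_period hk y m
  have h₁ := (hasDerivAt_jacobiCn hk (x + 4 * ellipticF k (Real.pi / 2) * m)).comp_add_const x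
    (4 * ellipticF k (Real.pi / 2) * m)
  rw [h] at h₁
  exact h₁.unique (hasDerivAt_jacobiCn hk x)

/-- The square root in the derivative depends only on sin², hence on cn. So value and derivative
give both cosine and sine of the amplitude, which is then known modulo 2π. -/
lemma eq_add_period_of_jacobiCn_eq {k x y : ℝ} (hk : k ^ 2 < 1) (h : jacobiCn x k = jacobiCn y k)
    (h' : jacobiCnDeriv x k = jacobiCnDeriv y k) :
    ∃ m : ℤ, y = x + 4 * ellipticF k (Real.pi / 2) * m := by
  have hc : Real.cos (jacobiAm x k) = Real.cos (jacobiAm y k) := h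
  have hs2 : Real.sin (jacobiAm x k) ^ 2 = Real.sin (jacobiAm y k) ^ 2 := by
    rw [Real.sin_sq, Real.sin_sq, hc]
  have hs : Real.sin (jacobiAm x k) = Real.sin (jacobiAm y k) := by
    rw [jacobiCnDeriv, jacobiCnDeriv, hs2, neg_inj] at h'
    exact mul_right_cancel₀ (sqrt_one_sub_mul_sin_sq_pos hk _).ne' h'
  obtain ⟨m, hm⟩ := (Real.Angle.angle_eq_iff_two_pi_dvd_sub).1
    (Real.Angle.cos_sin_inj hc.symm hs.symm)
  refine ⟨m, ?_⟩
  have hy : jacobiAm y k = jacobiAm x k + 2 * m * Real.pi := by linarith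
  rw [← ellipticF_jacobiAm hk y, hy, ellipticF_add_int_mul_two_pi hk, ellipticF_jacobiAm hk]

/-! ### From weak to classical derivatives -/

lemma exists_Ioo_of_isCompact_subset_Ioo {K : Set ℝ} {L : ℝ} (hL : 0 < L) (hK : IsCompact K)
    (hKL : K ⊆ Ioo 0 L) : ∃ a b, 0 < a ∧ b < L ∧ K ⊆ Ioo a b := by
  rcases K.eq_empty_or_nonempty with rfl | hne
  · exact ⟨L, 0, hL, hL, empty_subset _⟩
  · obtain ⟨a, ha⟩ := hK.exists_isLeast hne
    obtain ⟨b, hb⟩ := hK.exists_isGreatest hne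
    have ha0 := (hKL ha.1).1
    have hbL := (hKL hb.1).2
    exact ⟨a / 2, (b + L) / 2, by linarith, by linarith, fun x hx =>
      ⟨by linarith [ha.2 hx], by linarith [hb.2 hx]⟩⟩

lemma setIntegral_mul_eq_integral {L : ℝ} {f η : ℝ → ℝ} (hη : tsupport η ⊆ Ioo 0 L) :
    ∫ x in Ioo 0 L, f x * η x = ∫ x, f x * η x :=
  setIntegral_eq_integral_of_forall_compl_eq_zero fun x hx => by
    rw [image_eq_zero_of_notMem_tsupport fun h => hx (hη h), mul_zero]

/-- A test function on `(0, L)` with vanishing mean has a primitive which is a test function. -/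
lemma exists_testFunction_primitive {L : ℝ} (hL : 0 < L) {ψ : ℝ → ℝ}
    (hψ : ContDiff ℝ ((⊤ : ℕ∞) : WithTop ℕ∞) ψ) (hc : HasCompactSupport ψ)
    (hs : tsupport ψ ⊆ Ioo 0 L) (hint : ∫ x, ψ x = 0) :
    ∃ η : ℝ → ℝ, ContDiff ℝ ((⊤ : ℕ∞) : WithTop ℕ∞) η ∧ HasCompactSupport η ∧
      tsupport η ⊆ Ioo 0 L ∧ deriv η = ψ := by
  obtain ⟨a, b, ha, hb, hab⟩ := exists_Ioo_of_isCompact_subset_Ioo hL hc hs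
  have hzero : ∀ x, x ∉ Ioo a b → ψ x = 0 := fun x hx =>
    image_eq_zero_of_notMem_tsupport fun h => hx (hab h)
  have hderiv : ∀ x, HasDerivAt (fun x => ∫ t in a..x, ψ t) (ψ x) x := fun x =>
    (hψ.continuous.integral_hasStrictDerivAt a x).hasDerivAt
  have hd : deriv (fun x => ∫ t in a..x, ψ t) = ψ := funext fun x => (hderiv x).deriv
  have hsupp : Function.support (fun x => ∫ t in a..x, ψ t) ⊆ Icc a b := by
    intro x hx
    by_contra hxab
    apply hx
    rcases lt_or_ge x a with hxa | hxa
    · refine intervalIntegral.integral_zero_ae (Filter.Eventually.of_forall fun t ht =>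
        hzero t fun h => ?_)
      rw [uIoc_of_ge hxa.le] at ht
      exact ht.2.not_gt h.1
    · have hbx : b < x := not_le.1 fun h => hxab ⟨hxa, h⟩
      beta_reduce
      rw [intervalIntegral.integral_of_le hxa, ← hint]
      exact setIntegral_eq_integral_of_forall_compl_eq_zero fun t ht =>
        hzero t fun h => ht ⟨h.1, (h.2.trans hbx).le⟩
  exact ⟨fun x => ∫ t in a..x, ψ t, contDiff_infty_iff_deriv.2
    ⟨fun x => (hderiv x).differentiableAt, by rwa [hd]⟩,
    HasCompactSupport.of_support_subset_isCompact isCompact_Icc hsupp,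
    (closure_minimal hsupp isClosed_Icc).trans (Icc_subset_Ioo ha hb), hd⟩

/-- The du Bois-Reymond lemma. -/
lemma eqOn_const_of_integral_mul_deriv_eq_zero {L : ℝ} (hL : 0 < L) {h : ℝ → ℝ}
    (hcont : ContinuousOn h (Icc 0 L))
    (hint : ∀ η : ℝ → ℝ, ContDiff ℝ ((⊤ : ℕ∞) : WithTop ℕ∞) η → HasCompactSupport η →
      tsupport η ⊆ Ioo 0 L → ∫ x in Ioo 0 L, h x * deriv η x = 0) :
    ∃ c, ∀ x ∈ Icc 0 L, h x = c := by
  have hIoo : IntegrableOn h (Ioo 0 L) :=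
    hcont.integrableOn_Icc.mono_set Ioo_subset_Icc_self
  -- A bump of integral 1 supported in (0, L). The constant c will be the mean of h against it, and
  -- subtracting I ρ₁ from a test function of integral I leaves one with a primitive.
  let ρ : ContDiffBump (L / 2) := ⟨L / 8, L / 4, by positivity, by linarith⟩
  let ρ₁ : ℝ → ℝ := ρ.normed volume
  have hρs : tsupport ρ₁ ⊆ Ioo 0 L := by
    rw [ρ.tsupport_normed_eq, Real.closedBall_eq_Icc]
    exact Icc_subset_Ioo (by change 0 < L / 2 - L / 4; linarith)
      (by change L / 2 + L / 4 < L; linarith)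
  have hρd : ContDiff ℝ ((⊤ : ℕ∞) : WithTop ℕ∞) ρ₁ := ρ.contDiff_normed
  have hρc : HasCompactSupport ρ₁ := ρ.hasCompactSupport_normed
  have hρ1 : ∫ x, ρ₁ x = 1 := ρ.integral_normed
  have hbdd : ∀ η : ℝ → ℝ, Continuous η → HasCompactSupport η →
      IntegrableOn (fun x => h x * η x) (Ioo 0 L) := fun η hη hηc => by
    obtain ⟨C, hC⟩ := hηc.exists_bound_of_continuous hη
    exact Integrable.mul_bdd (c := C) hIoo hη.aestronglyMeasurable
      (Filter.Eventually.of_forall hC)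
  set c := ∫ x in Ioo 0 L, h x * ρ₁ x with hc
  have hae : ∀ᵐ x, x ∈ Ioo 0 L → h x - c = 0 := by
    refine isOpen_Ioo.ae_eq_zero_of_integral_contDiff_smul_eq_zero
      (hIoo.sub (integrableOn_const (by simp))).locallyIntegrableOn fun ζ hζ hζc hζs => ?_
    set I := ∫ x, ζ x with hI
    have hsub : tsupport (fun x => ζ x - I * ρ₁ x) ⊆ Ioo 0 L := by
      refine (closure_minimal (s := Function.support _) (t := tsupport ζ ∪ tsupport ρ₁)
        (fun x hx => ?_) ((isClosed_tsupport _).union (isClosed_tsupport _))).trans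
        (union_subset hζs hρs)
      by_contra hx'
      rw [mem_union, not_or] at hx'
      refine hx ?_
      simp [image_eq_zero_of_notMem_tsupport hx'.1, image_eq_zero_of_notMem_tsupport hx'.2]
    have hζi : Integrable ζ := hζ.continuous.integrable_of_hasCompactSupport hζc
    have hρi : Integrable ρ₁ := hρd.continuous.integrable_of_hasCompactSupport hρc
    obtain ⟨η, hη, hηc, hηs, hηd⟩ := exists_testFunction_primitive hL
      (hζ.sub (contDiff_const.mul hρd))
      (hζc.sub (hρc.mul_left (f := fun _ => I))) hsub (by
        rw [integral_sub hζi (hρi.const_mul I), integral_const_mul, hρ1, mul_one, sub_self])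
    have h0 := hint η hη hηc hηs
    rw [hηd] at h0
    have hsplit : ∫ x in Ioo 0 L, h x * (ζ x - I * ρ₁ x) =
        (∫ x in Ioo 0 L, h x * ζ x) - I * c := by
      rw [hc, ← integral_const_mul, ← integral_sub (hbdd ζ hζ.continuous hζc)
        ((hbdd ρ₁ hρd.continuous hρc).const_mul I)]
      congr 1 with x
      ring
    have hζI : ∫ x in Ioo 0 L, c * ζ x = c * I := by
      rw [setIntegral_mul_eq_integral hζs, integral_const_mul]
    have hfin : ∫ x in Ioo 0 L, (h x - c) * ζ x = 0 := by
      have : ∫ x in Ioo 0 L, (h x - c) * ζ x =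
          (∫ x in Ioo 0 L, h x * ζ x) - ∫ x in Ioo 0 L, c * ζ x := by
        rw [← integral_sub (hbdd ζ hζ.continuous hζc) (hζi.const_mul c).integrableOn]
        congr 1 with x
        ring
      rw [this, hζI]
      linarith [hsplit.symm.trans h0]
    rw [setIntegral_mul_eq_integral hζs] at hfin
    rw [← hfin]
    congr 1 with x
    simp [mul_comm]
  refine ⟨c, Measure.eqOn_Icc_of_ae_eq volume hL.ne ?_ hcont continuousOn_const⟩
  rw [← restrict_Ioo_eq_restrict_Icc, Filter.EventuallyEq, ae_restrict_iff' measurableSet_Ioo]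
  filter_upwards [hae] with x hx hxm
  linarith [hx hxm]

lemma hasWeakDeriv_of_hasDerivAt {f g : ℝ → ℝ} {L : ℝ} (hL : 0 < L)
    (hf : ∀ x, HasDerivAt f (g x) x) (hg : Continuous g) : HasWeakDeriv L f g := by
  intro η hη hηc hηs
  have hη0 : ∀ x, x ∉ Ioo 0 L → η x = 0 := fun x hx =>
    image_eq_zero_of_notMem_tsupport fun h => hx (hηs h)
  have hηd : Continuous (deriv η) := hη.continuous_deriv (by simp)
  have h := intervalIntegral.integral_mul_deriv_eq_deriv_mul (a := 0) (b := L) (u := f) (v := η)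
    (u' := g) (v' := deriv η) (fun x _ => hf x)
    (fun x _ => ((hη.differentiable (by simp)) x).hasDerivAt) (hg.intervalIntegrable _ _)
    (hηd.intervalIntegrable _ _)
  rw [hη0 0 (by simp), hη0 L (by simp), intervalIntegral.integral_of_le hL.le,
    intervalIntegral.integral_of_le hL.le, integral_Ioc_eq_integral_Ioo,
    integral_Ioc_eq_integral_Ioo] at h
  rw [h]
  ring

/-- If F is a primitive of g, then f − F has zero weak derivative and is constant on [0, L].
Extending g by constants makes F differentiable at the endpoints too. -/
lemma HasWeakDeriv.hasDerivWithinAt {f g : ℝ → ℝ} {L : ℝ} (hL : 0 < L) (h : HasWeakDeriv L f g)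
    (hf : ContinuousOn f (Icc 0 L)) (hg : ContinuousOn g (Icc 0 L)) :
    ∀ x ∈ Icc 0 L, HasDerivWithinAt f (g x) (Icc 0 L) x := by
  let g₁ : ℝ → ℝ := IccExtend hL.le ((Icc 0 L).domRestrict g)
  have hg₁ : Continuous g₁ := (continuousOn_iff_continuous_domRestrict.1 hg).Icc_extend'
  have hgg₁ : ∀ x ∈ Icc 0 L, g₁ x = g x := fun x hx => IccExtend_of_mem hL.le _ hx
  let F : ℝ → ℝ := fun x => ∫ t in (0 : ℝ)..x, g₁ t
  have hF : ∀ x, HasDerivAt F (g₁ x) x := fun x =>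
    (hg₁.integral_hasStrictDerivAt 0 x).hasDerivAt
  have hFc : Continuous F := continuous_iff_continuousAt.2 fun x => (hF x).continuousAt
  have hFw := hasWeakDeriv_of_hasDerivAt hL hF hg₁
  obtain ⟨c, hc⟩ := eqOn_const_of_integral_mul_deriv_eq_zero hL (h := fun x => f x - F x)
    (hf.sub hFc.continuousOn) fun η hη hηc hηs => by
    obtain ⟨C, hC⟩ := hηc.deriv.exists_bound_of_continuous (hη.continuous_deriv (by simp))
    have hbdd : ∀ p : ℝ → ℝ, ContinuousOn p (Icc 0 L) →
        IntegrableOn (fun x => p x * deriv η x) (Ioo 0 L) := fun p hp =>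
      Integrable.mul_bdd (c := C) (hp.integrableOn_Icc.mono_set Ioo_subset_Icc_self)
        (hη.continuous_deriv (by simp)).aestronglyMeasurable (Filter.Eventually.of_forall hC)
    have h₁ := h η hη hηc hηs
    have h₂ := hFw η hη hηc hηs
    have h₃ : ∫ x in Ioo 0 L, g₁ x * η x = ∫ x in Ioo 0 L, g x * η x :=
      setIntegral_congr_fun measurableSet_Ioo fun x hx => by
        simp only [hgg₁ x (Ioo_subset_Icc_self hx)]
    simp only [sub_mul]
    rw [integral_sub (hbdd f hf) (hbdd F hFc.continuousOn), h₁, h₂, h₃, sub_self]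
  intro x hx
  rw [← hgg₁ x hx]
  exact (((hF x).add_const c).hasDerivWithinAt).congr
    (fun y hy => by linarith [hc y hy]) (by linarith [hc x hx])

/-! ### Uniqueness for the Cauchy problem -/

lemma lipschitzOnWith_cubic_field (w R : ℝ) (hR : 0 ≤ R) :
    ∃ K : NNReal, LipschitzOnWith K (fun p : ℝ × ℝ => (p.2, w * p.1 - p.1 ^ 3))
      {p | |p.1| ≤ R} := by
  refine ⟨⟨max 1 (|w| + 3 * R ^ 2), by positivity⟩, LipschitzOnWith.of_dist_le_mul ?_⟩
  intro p hp q hq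
  have hp : |p.1| ≤ R := hp
  have hq : |q.1| ≤ R := hq
  have hM : (0 : ℝ) ≤ max 1 (|w| + 3 * R ^ 2) := by positivity
  rw [Prod.dist_eq (x := (p.2, w * p.1 - p.1 ^ 3))]
  refine max_le ?_ ?_
  · calc dist p.2 q.2 ≤ 1 * dist p q := by rw [one_mul, Prod.dist_eq]; exact le_max_right _ _
      _ ≤ _ := by
        refine mul_le_mul_of_nonneg_right ?_ dist_nonneg
        exact le_max_left _ _
  · have hfac : w * p.1 - p.1 ^ 3 - (w * q.1 - q.1 ^ 3) =
        (w - (p.1 ^ 2 + p.1 * q.1 + q.1 ^ 2)) * (p.1 - q.1) := by ring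
    change dist (w * p.1 - p.1 ^ 3) (w * q.1 - q.1 ^ 3) ≤ _
    rw [Real.dist_eq, hfac, abs_mul]
    refine mul_le_mul (le_trans ?_ (le_max_right _ _)) ?_ (abs_nonneg _) hM
    · refine (abs_sub _ _).trans (add_le_add le_rfl ?_)
      refine ((abs_add_le _ _).trans (add_le_add_left (abs_add_le _ _) _)).trans ?_
      rw [abs_mul, abs_pow, abs_pow]
      nlinarith [abs_nonneg p.1, abs_nonneg q.1]
    · rw [← Real.dist_eq, Prod.dist_eq]; exact le_max_left _ _

/-- Uniqueness of the solution of the Cauchy problem for `u'' = w u - u³`. -/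
lemma eqOn_of_cubic_ode {w L : ℝ} {u u' v v' : ℝ → ℝ}
    (hu : ∀ x ∈ Icc 0 L, HasDerivWithinAt u (u' x) (Icc 0 L) x)
    (hu' : ∀ x ∈ Icc 0 L, HasDerivWithinAt u' (w * u x - u x ^ 3) (Icc 0 L) x)
    (hv : ∀ x, HasDerivAt v (v' x) x)
    (hv' : ∀ x, HasDerivAt v' (w * v x - v x ^ 3) x)
    (h0 : u 0 = v 0) (h0' : u' 0 = v' 0) : EqOn u v (Icc 0 L) ∧ EqOn u' v' (Icc 0 L) := by
  have huc : ContinuousOn u (Icc 0 L) := fun x hx => (hu x hx).continuousWithinAt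
  have huc' : ContinuousOn u' (Icc 0 L) := fun x hx => (hu' x hx).continuousWithinAt
  have hvc : Continuous v := continuous_iff_continuousAt.2 fun x => (hv x).continuousAt
  have hvc' : Continuous v' := continuous_iff_continuousAt.2 fun x => (hv' x).continuousAt
  obtain ⟨R₁, hR₁⟩ := isCompact_Icc.exists_bound_of_continuousOn huc
  obtain ⟨R₂, hR₂⟩ := isCompact_Icc.exists_bound_of_continuousOn
    (hvc.continuousOn (s := Icc 0 L))
  obtain ⟨K, hK⟩ := lipschitzOnWith_cubic_field w (max 0 (max R₁ R₂)) (le_max_left _ _)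
  have hmem : ∀ x ∈ Ico 0 L, Icc 0 L ∈ nhdsWithin x (Ici x) := fun x hx =>
    Filter.mem_of_superset (Icc_mem_nhdsGE hx.2) (Icc_subset_Icc_left hx.1)
  have key := ODE_solution_unique_of_mem_Icc_right (K := K) (a := 0) (b := L)
    (v := fun _ (p : ℝ × ℝ) => (p.2, w * p.1 - p.1 ^ 3))
    (s := fun _ => {p | |p.1| ≤ max 0 (max R₁ R₂)})
    (f := fun x => (u x, u' x)) (g := fun x => (v x, v' x))
    (fun _ _ => hK) (huc.prodMk huc')
    (fun x hx => ((hu x (Ico_subset_Icc_self hx)).prodMk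
      (hu' x (Ico_subset_Icc_self hx))).mono_of_mem_nhdsWithin (hmem x hx))
    (fun x hx => (hR₁ x (Ico_subset_Icc_self hx)).trans
      ((le_max_left _ _).trans (le_max_right _ _)))
    (hvc.prodMk hvc').continuousOn
    (fun x _ => ((hv x).prodMk (hv' x)).hasDerivWithinAt)
    (fun x hx => (hR₂ x (Ico_subset_Icc_self hx)).trans
      ((le_max_right _ _).trans (le_max_right _ _)))
    (by simp only [h0, h0'])
  exact ⟨fun x hx => congrArg Prod.fst (key hx), fun x hx => congrArg Prod.snd (key hx)⟩

/-! ### Cnoidal waves: equation, levels, periods -/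

/-- The cnoidal wave of frequency `-w`, modulus `k` and shift `s`. -/
noncomputable def cnWave (w k s x : ℝ) : ℝ :=
  Real.sqrt (2 * w * k ^ 2 / (2 * k ^ 2 - 1)) *
    jacobiCn (Real.sqrt (w / (2 * k ^ 2 - 1)) * (x - s)) k

/-- The derivative of `cnWave`. -/
noncomputable def cnWaveDeriv (w k s x : ℝ) : ℝ :=
  Real.sqrt (2 * w * k ^ 2 / (2 * k ^ 2 - 1)) *
    (jacobiCnDeriv (Real.sqrt (w / (2 * k ^ 2 - 1)) * (x - s)) k *
      Real.sqrt (w / (2 * k ^ 2 - 1)))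

lemma profile_eq_cnWave (L ω : ℝ) (n : ℕ) (s : ℝ) :
    profile L ω n s = cnWave |ω| (modulus L ω n) s := rfl

section
variable {w k : ℝ}

lemma waveNumber_pos (hw : 0 < w) (hk : k ∈ moduli) : 0 < Real.sqrt (w / (2 * k ^ 2 - 1)) := by
  obtain ⟨_, _, h2, _⟩ := moduli_bounds hk
  exact Real.sqrt_pos.2 (div_pos hw (by linarith))

lemma amplitude_pos (hw : 0 < w) (hk : k ∈ moduli) :
    0 < Real.sqrt (2 * w * k ^ 2 / (2 * k ^ 2 - 1)) := by
  obtain ⟨h0, _, h2, _⟩ := moduli_bounds hk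
  exact Real.sqrt_pos.2 (div_pos (by positivity) (by linarith))

lemma hasDerivAt_cnWave (hk : k ∈ moduli) (s x : ℝ) :
    HasDerivAt (cnWave w k s) (cnWaveDeriv w k s x) x := by
  have hlin : HasDerivAt (fun x => Real.sqrt (w / (2 * k ^ 2 - 1)) * (x - s))
      (Real.sqrt (w / (2 * k ^ 2 - 1))) x := by
    simpa using ((hasDerivAt_id x).sub_const s).const_mul (Real.sqrt (w / (2 * k ^ 2 - 1)))
  exact ((hasDerivAt_jacobiCn (moduli_bounds hk).2.2.2 _).comp x hlin).const_mul _

/-- The amplitude A and wave number B fit the equation of cn: B²(2k² − 1) = w matches the linear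
term, and A² = 2k²B² the cubic one. -/
lemma hasDerivAt_cnWaveDeriv (hw : 0 < w) (hk : k ∈ moduli) (s x : ℝ) :
    HasDerivAt (cnWaveDeriv w k s) (w * cnWave w k s x - cnWave w k s x ^ 3) x := by
  obtain ⟨h0, h1, h2, h3⟩ := moduli_bounds hk
  have hlin : HasDerivAt (fun x => Real.sqrt (w / (2 * k ^ 2 - 1)) * (x - s))
      (Real.sqrt (w / (2 * k ^ 2 - 1))) x := by
    simpa using ((hasDerivAt_id x).sub_const s).const_mul (Real.sqrt (w / (2 * k ^ 2 - 1)))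
  refine ((((hasDerivAt_jacobiCnDeriv h3 _).comp x hlin).mul_const _).const_mul _).congr_deriv ?_
  have hd : 0 < 2 * k ^ 2 - 1 := by linarith
  have hA := Real.sq_sqrt (show 0 ≤ 2 * w * k ^ 2 / (2 * k ^ 2 - 1) by positivity)
  have hB := Real.sq_sqrt (show 0 ≤ w / (2 * k ^ 2 - 1) by positivity)
  simp only [cnWave]
  set A := Real.sqrt (2 * w * k ^ 2 / (2 * k ^ 2 - 1))
  set B := Real.sqrt (w / (2 * k ^ 2 - 1))
  set c := jacobiCn (B * (x - s)) k
  rw [show A * (((2 * k ^ 2 - 1) * c - 2 * k ^ 2 * c ^ 3) * B * B) =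
      A * c * (2 * k ^ 2 - 1) * B ^ 2 - 2 * k ^ 2 * A * c ^ 3 * B ^ 2 by ring,
    show w * (A * c) - (A * c) ^ 3 = w * (A * c) - A * c ^ 3 * A ^ 2 by ring, hA, hB]
  field_simp

lemma continuous_cnWave (hk : k ∈ moduli) (s : ℝ) : Continuous (cnWave w k s) :=
  continuous_iff_continuousAt.2 fun x => (hasDerivAt_cnWave hk s x).continuousAt

lemma continuous_cnWaveDeriv (hw : 0 < w) (hk : k ∈ moduli) (s : ℝ) :
    Continuous (cnWaveDeriv w k s) :=
  continuous_iff_continuousAt.2 fun x => (hasDerivAt_cnWaveDeriv hw hk s x).continuousAt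

lemma amplitude_mul_cos_crossingAngle (hw : 0 < w) (hk : k ∈ moduli) :
    Real.sqrt (2 * w * k ^ 2 / (2 * k ^ 2 - 1)) * Real.cos (crossingAngle k) =
      Real.sqrt (2 * w) := by
  obtain ⟨h0, h1, h2, h3⟩ := moduli_bounds hk
  have hd : 0 < 2 * k ^ 2 - 1 := by linarith
  rw [cos_crossingAngle h2.le h3, ← Real.sqrt_mul (by positivity)]
  congr 1
  field_simp

lemma jacobiCn_ellipticF_crossingAngle (hk : k ∈ moduli) :
    jacobiCn (ellipticF k (crossingAngle k)) k = Real.cos (crossingAngle k) := by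
  rw [jacobiCn, jacobiAm_ellipticF (moduli_bounds hk).2.2.2]

lemma ellipticF_crossingAngle (hk : k ∈ moduli) :
    ellipticF k (crossingAngle k) = phi k * ellipticF k (Real.pi / 2) := by
  obtain ⟨h0, h1, h2, h3⟩ := moduli_bounds hk
  rw [phi_eq h2.le h3, div_mul_cancel₀ _ (ellipticF_pi_div_two_pos h3).ne']

/-- Translates "L is n periods of the wave" into the equation that `SInv` solves. -/
lemma waveNumber_mul_eq_iff (hk : k ∈ moduli) (hw : 0 < w) {L : ℝ} {n : ℕ} (hn : 1 ≤ n) :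
    Real.sqrt (w / (2 * k ^ 2 - 1)) * L = 4 * ellipticF k (Real.pi / 2) * n ↔
      S k = L * (Real.sqrt w / n) := by
  obtain ⟨h0, h1, h2, h3⟩ := moduli_bounds hk
  have hd : 0 < Real.sqrt (2 * k ^ 2 - 1) := Real.sqrt_pos.2 (by linarith)
  have hn : (0 : ℝ) < n := by exact_mod_cast hn
  rw [S_eq, Real.sqrt_div hw.le, div_mul_eq_mul_div, div_eq_iff hd.ne', ← mul_div_assoc,
    eq_div_iff hn.ne']
  constructor <;> intro h <;> linarith

/-- `z` belongs to `±δ + ℤ`. -/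
def IsLevel (δ z : ℝ) : Prop :=
  ∃ m : ℤ, z = m + δ ∨ z = m - δ

/-- The number n(x − s)/L is the phase in periods. The wave equals √(2w) at phase φ/4, because there
the amplitude angle is the crossing angle. For ε = −1 the term (1 − ε)/4 is the half period that
changes the sign of cn. -/
lemma cnWave_eq_level_iff (hw : 0 < w) (hk : k ∈ moduli) {L : ℝ} (hL : 0 < L) {n : ℕ}
    (hn : Real.sqrt (w / (2 * k ^ 2 - 1)) * L = 4 * ellipticF k (Real.pi / 2) * n)
    {ε : ℝ} (hε : ε = 1 ∨ ε = -1) (s x : ℝ) :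
    ε * cnWave w k s x = Real.sqrt (2 * w) ↔
      IsLevel ((1 - ε) / 4 + phi k / 4) (n / L * (x - s)) := by
  obtain ⟨h0, h1, h2, h3⟩ := moduli_bounds hk
  have hA := amplitude_pos hw hk
  have hK := ellipticF_pi_div_two_pos h3
  set K := ellipticF k (Real.pi / 2) with hKdef
  have hcn : ε * cnWave w k s x = Real.sqrt (2 * w) ↔
      jacobiCn (4 * K * ((1 - ε) / 4 + phi k / 4)) k =
        jacobiCn (Real.sqrt (w / (2 * k ^ 2 - 1)) * (x - s)) k := by
    have hlevel : jacobiCn (4 * K * ((1 - ε) / 4 + phi k / 4)) k =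
        ε * Real.cos (crossingAngle k) := by
      rw [← jacobiCn_ellipticF_crossingAngle hk, ellipticF_crossingAngle hk, ← hKdef]
      rcases hε with rfl | rfl
      · rw [one_mul]; congr 1; ring
      · rw [neg_one_mul, ← jacobiCn_add_half_period h3]; congr 1; ring
    rw [hlevel, cnWave, ← amplitude_mul_cos_crossingAngle hw hk, mul_left_comm,
      mul_right_inj' hA.ne']
    rcases hε with rfl | rfl
    · rw [one_mul, one_mul, eq_comm]
    · constructor <;> intro h <;> linarith
  have hB : Real.sqrt (w / (2 * k ^ 2 - 1)) * (x - s) = 4 * K * (n / L * (x - s)) := by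
    rw [eq_div_of_mul_eq hL.ne' hn]; ring
  rw [hcn, jacobiCn_eq_iff h3, hB, ← hKdef, IsLevel]
  refine exists_congr fun m => or_congr ?_ ?_
  · rw [← mul_add, mul_right_inj' (by positivity)]
  · rw [← mul_sub, mul_right_inj' (by positivity)]

lemma cnWave_shift (hk : k ∈ moduli) {L : ℝ} (hL : 0 < L) {n : ℕ}
    (hn : Real.sqrt (w / (2 * k ^ 2 - 1)) * L = 4 * ellipticF k (Real.pi / 2) * n)
    {s t : ℝ} {m : ℤ} (hst : n / L * (s - t) = m) : cnWave w k s = cnWave w k t := by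
  funext x
  have hB : Real.sqrt (w / (2 * k ^ 2 - 1)) * (x - t) =
      Real.sqrt (w / (2 * k ^ 2 - 1)) * (x - s) + 4 * ellipticF k (Real.pi / 2) * m := by
    rw [← hst, eq_div_of_mul_eq hL.ne' hn]; ring
  rw [cnWave, cnWave, hB, jacobiCn_add_int_mul_period (moduli_bounds hk).2.2.2]

lemma cnWave_periodic (hk : k ∈ moduli) {L : ℝ} (hL : 0 < L) {n : ℕ}
    (hn : Real.sqrt (w / (2 * k ^ 2 - 1)) * L = 4 * ellipticF k (Real.pi / 2) * n) (s : ℝ)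
    (m : ℕ) (hn1 : 1 ≤ n) : Function.Periodic (cnWave w k s) (m * (L / n)) := by
  intro x
  have hn0 : (n : ℝ) ≠ 0 := by positivity
  have hB : Real.sqrt (w / (2 * k ^ 2 - 1)) * (x + m * (L / n) - s) =
      Real.sqrt (w / (2 * k ^ 2 - 1)) * (x - s) +
        4 * ellipticF k (Real.pi / 2) * ((m : ℤ) : ℝ) := by
    rw [eq_div_of_mul_eq hL.ne' hn]
    push_cast
    field_simp
    ring
  rw [cnWave, cnWave, hB, jacobiCn_add_int_mul_period (moduli_bounds hk).2.2.2]

lemma cnWaveDeriv_periodic (hk : k ∈ moduli) {L : ℝ} {n : ℕ}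
    (hn : Real.sqrt (w / (2 * k ^ 2 - 1)) * L = 4 * ellipticF k (Real.pi / 2) * n) (s : ℝ) :
    Function.Periodic (cnWaveDeriv w k s) L := by
  intro x
  have hB : Real.sqrt (w / (2 * k ^ 2 - 1)) * (x + L - s) =
      Real.sqrt (w / (2 * k ^ 2 - 1)) * (x - s) +
        4 * ellipticF k (Real.pi / 2) * ((n : ℤ) : ℝ) := by
    push_cast
    rw [← hn]; ring
  rw [cnWaveDeriv, cnWaveDeriv, hB, jacobiCnDeriv_add_int_mul_period (moduli_bounds hk).2.2.2]

lemma isLeast_period_cnWave (hw : 0 < w) (hk : k ∈ moduli) {L : ℝ} (hL : 0 < L) {n : ℕ}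
    (hn : Real.sqrt (w / (2 * k ^ 2 - 1)) * L = 4 * ellipticF k (Real.pi / 2) * n) (hn1 : 1 ≤ n)
    (s : ℝ) : IsLeast {T : ℝ | 0 < T ∧ Function.Periodic (cnWave w k s) T} (L / n) := by
  have h3 := (moduli_bounds hk).2.2.2
  have hn0 : (0 : ℝ) < n := by exact_mod_cast hn1
  refine ⟨⟨by positivity, by simpa using cnWave_periodic hk hL hn s 1 hn1⟩, ?_⟩
  rintro T ⟨hT, hper⟩
  have hK := ellipticF_pi_div_two_pos h3
  have hB := waveNumber_pos hw hk
  -- At the crest x = s both alternatives of `jacobiCn_eq_iff` coincide, so T must be a whole number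
  -- m of periods.
  have h := mul_left_cancel₀ (amplitude_pos hw hk).ne' (hper s)
  rw [sub_self, mul_zero, add_sub_cancel_left] at h
  obtain ⟨m, hm⟩ := (jacobiCn_eq_iff h3 _ _).1 h.symm
  have hm' : Real.sqrt (w / (2 * k ^ 2 - 1)) * T = 4 * ellipticF k (Real.pi / 2) * m := by
    rcases hm with hm | hm <;> linarith
  have hmpos : (0 : ℝ) < m := by
    have : 0 < 4 * ellipticF k (Real.pi / 2) * m := hm' ▸ mul_pos hB hT
    exact pos_of_mul_pos_right this (by positivity)
  have hm1 : (1 : ℝ) ≤ m := by exact_mod_cast Int.cast_pos.1 hmpos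
  rw [div_le_iff₀ hn0]
  refine le_of_mul_le_mul_left ?_ hB
  rw [hn, ← mul_assoc, hm']
  have : 0 ≤ 4 * ellipticF k (Real.pi / 2) * n := by positivity
  nlinarith

end

/-! ### Solutions of the boundary value problem are cnoidal waves -/

/-- The left side is the squared slope of the wave of modulus k at the level √(2w). In terms of t =
2k² − 1 it equals w²(1 − t²)/(2t²), which gives t² = 1/(1 + 2p²/w²). -/
lemma exists_modulus {w p : ℝ} (hw : 0 < w) (hp : p ≠ 0) :
    ∃ k ∈ moduli, 2 * w ^ 2 * k ^ 2 * (1 - k ^ 2) / (2 * k ^ 2 - 1) ^ 2 = p ^ 2 := by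
  set D := 1 + 2 * p ^ 2 / w ^ 2 with hD
  have hp2 : 0 < p ^ 2 := by positivity
  have hD1 : 1 < D := by
    have : 0 < 2 * p ^ 2 / w ^ 2 := by positivity
    linarith
  set t := 1 / Real.sqrt D with ht
  have hsD : 1 < Real.sqrt D := by rw [Real.lt_sqrt zero_le_one]; linarith
  have ht0 : 0 < t := by positivity
  have ht1 : t < 1 := by rw [ht, div_lt_one (by linarith)]; exact hsD
  have htsq : t ^ 2 * D = 1 := by
    rw [ht, div_pow, Real.sq_sqrt (by linarith), one_pow, one_div_mul_cancel (by linarith)]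
  have hk : Real.sqrt ((1 + t) / 2) ^ 2 = (1 + t) / 2 := Real.sq_sqrt (by positivity)
  refine ⟨Real.sqrt ((1 + t) / 2), mem_moduli (Real.sqrt_nonneg _) ?_ ?_, ?_⟩
  · rw [hk]; linarith
  · rw [hk]; linarith
  · rw [hk, show 2 * ((1 + t) / 2) - 1 = t by ring, div_eq_iff (by positivity)]
    have hw2 : w ^ 2 ≠ 0 := by positivity
    rw [hD] at htsq
    field_simp at htsq
    linear_combination (-1 / 2) * htsq

/-- Every Cauchy datum `(√(2w), p)` with `p ≠ 0` is that of a cnoidal wave. -/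
lemma exists_cnWave_initial {w p : ℝ} (hw : 0 < w) (hp : p ≠ 0) :
    ∃ k ∈ moduli, ∃ s, cnWave w k s 0 = Real.sqrt (2 * w) ∧ cnWaveDeriv w k s 0 = p := by
  obtain ⟨k, hk, hkp⟩ := exists_modulus hw hp
  obtain ⟨h0, h1, h2, h3⟩ := moduli_bounds hk
  have hB := waveNumber_pos hw hk
  have hA := amplitude_pos hw hk
  have hd : 0 < 2 * k ^ 2 - 1 := by linarith
  have ha := crossingAngle_mem hk
  have hsin : 0 < Real.sin (crossingAngle k) :=
    Real.sin_pos_of_pos_of_lt_pi ha.1 (by linarith [ha.2, Real.pi_pos])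
  have hsin2 := sq_sin_crossingAngle h2.le h3
  have hA2 := Real.sq_sqrt (show 0 ≤ 2 * w * k ^ 2 / (2 * k ^ 2 - 1) by positivity)
  have hB2 := Real.sq_sqrt (show 0 ≤ w / (2 * k ^ 2 - 1) by positivity)
  have habs : Real.sqrt (2 * w * k ^ 2 / (2 * k ^ 2 - 1)) * (Real.sin (crossingAngle k) * k *
      Real.sqrt (w / (2 * k ^ 2 - 1))) = |p| := by
    rw [← abs_of_pos (show 0 < Real.sqrt (2 * w * k ^ 2 / (2 * k ^ 2 - 1)) *
      (Real.sin (crossingAngle k) * k * Real.sqrt (w / (2 * k ^ 2 - 1))) by positivity),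
      ← sq_eq_sq_iff_abs_eq_abs, ← hkp]
    rw [show (Real.sqrt (2 * w * k ^ 2 / (2 * k ^ 2 - 1)) * (Real.sin (crossingAngle k) * k *
      Real.sqrt (w / (2 * k ^ 2 - 1)))) ^ 2 = Real.sqrt (2 * w * k ^ 2 / (2 * k ^ 2 - 1)) ^ 2 *
      (k ^ 2 * Real.sin (crossingAngle k) ^ 2) * Real.sqrt (w / (2 * k ^ 2 - 1)) ^ 2 by ring,
      hA2, hB2, hsin2]
    field_simp
  have hdn : Real.sqrt (1 - k ^ 2 * Real.sin (crossingAngle k) ^ 2) = k := by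
    rw [hsin2, sub_sub_cancel, Real.sqrt_sq h0.le]
  -- The crossing angle and its opposite give the same value and opposite slopes, so the sign of p
  -- selects one of them.
  have key : ∀ θ, (θ = crossingAngle k ∨ θ = -crossingAngle k) →
      cnWave w k (ellipticF k θ / Real.sqrt (w / (2 * k ^ 2 - 1))) 0 = Real.sqrt (2 * w) ∧
      cnWaveDeriv w k (ellipticF k θ / Real.sqrt (w / (2 * k ^ 2 - 1))) 0 =
        Real.sqrt (2 * w * k ^ 2 / (2 * k ^ 2 - 1)) * (Real.sin θ * k *
          Real.sqrt (w / (2 * k ^ 2 - 1))) := by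
    intro θ hθ
    have harg : Real.sqrt (w / (2 * k ^ 2 - 1)) *
        (0 - ellipticF k θ / Real.sqrt (w / (2 * k ^ 2 - 1))) = ellipticF k (-θ) := by
      rw [ellipticF_neg]; field_simp; ring
    have hcos : Real.cos θ = Real.cos (crossingAngle k) := by
      rcases hθ with rfl | rfl <;> simp
    have hs2 : Real.sin θ ^ 2 = Real.sin (crossingAngle k) ^ 2 := by
      rcases hθ with rfl | rfl <;> simp
    constructor
    · rw [cnWave, harg, jacobiCn, jacobiAm_ellipticF h3, Real.cos_neg, hcos,
        amplitude_mul_cos_crossingAngle hw hk]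
    · rw [cnWaveDeriv, harg, jacobiCnDeriv, jacobiAm_ellipticF h3, Real.sin_neg, neg_sq, hs2, hdn]
      ring
  rcases hp.lt_or_gt with hneg | hpos
  · obtain ⟨e₁, e₂⟩ := key _ (Or.inr rfl)
    refine ⟨k, hk, _, e₁, ?_⟩
    rw [e₂, Real.sin_neg, neg_mul, neg_mul, mul_neg, habs, abs_of_neg hneg, neg_neg]
  · obtain ⟨e₁, e₂⟩ := key _ (Or.inl rfl)
    refine ⟨k, hk, _, e₁, ?_⟩
    rw [e₂, habs, abs_of_pos hpos]

/-- The homoclinic solution is not periodic, so a periodic one crosses the level `√(2w)`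
transversally. -/
lemma deriv_ne_zero_of_periodic {w L : ℝ} (hw : 0 < w) (hL : 0 < L) {u u' : ℝ → ℝ}
    (hu : ∀ x ∈ Icc 0 L, HasDerivWithinAt u (u' x) (Icc 0 L) x)
    (hu' : ∀ x ∈ Icc 0 L, HasDerivWithinAt u' (w * u x - u x ^ 3) (Icc 0 L) x)
    (h0 : u 0 = Real.sqrt (2 * w)) (hper : u 0 = u L) : u' 0 ≠ 0 := by
  intro h0'
  set a := Real.sqrt w with ha
  set A := Real.sqrt (2 * w) with hA
  have ha0 : 0 < a := Real.sqrt_pos.2 hw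
  have hA0 : 0 < A := Real.sqrt_pos.2 (by linarith)
  have ha2 : a ^ 2 = w := Real.sq_sqrt hw.le
  have hA2 : A ^ 2 = 2 * w := Real.sq_sqrt (by linarith)
  have hlin : ∀ x, HasDerivAt (fun x : ℝ => a * x) a x := fun x => by
    simpa using (hasDerivAt_id x).const_mul a
  -- The explicit solution √(2w) sech(√w x) has the data (√(2w), 0); it is strictly smaller at L
  -- than at 0.
  have hv : ∀ x, HasDerivAt (fun x => A / Real.cosh (a * x))
      (-A * a * (Real.sinh (a * x) / Real.cosh (a * x) ^ 2)) x := fun x => by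
    refine ((hasDerivAt_const x A).div (hlin x).cosh (Real.cosh_pos _).ne').congr_deriv ?_
    ring
  have hv' : ∀ x, HasDerivAt (fun x => -A * a * (Real.sinh (a * x) / Real.cosh (a * x) ^ 2))
      (w * (A / Real.cosh (a * x)) - (A / Real.cosh (a * x)) ^ 3) x := fun x => by
    have hc := Real.cosh_pos (a * x)
    refine (((hlin x).sinh.div ((hlin x).cosh.pow 2) (pow_pos hc 2).ne').const_mul
      (-A * a)).congr_deriv ?_
    have hcs := Real.cosh_sq (a * x)
    simp only [Pi.pow_apply]
    field_simp
    rw [show Real.sinh (a * x) ^ 2 = Real.cosh (a * x) ^ 2 - 1 by linarith, hA2, ha2]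
    ring
  have key := (eqOn_of_cubic_ode hu hu' hv hv' (by simpa using h0) (by simpa using h0')).1
    (right_mem_Icc.2 hL.le)
  rw [← hper, h0] at key
  have hcosh : 1 < Real.cosh (a * L) := Real.one_lt_cosh.2 (by positivity)
  have : A / Real.cosh (a * L) < A := div_lt_self hA0 hcosh
  linarith

lemma memLp_of_continuous {f : ℝ → ℝ} (hf : Continuous f) (L : ℝ) :
    MemLp f 2 (volume.restrict (Ioo 0 L)) := by
  obtain ⟨C, hC⟩ := isCompact_Icc.exists_bound_of_continuousOn (hf.continuousOn (s := Icc 0 L))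
  refine MemLp.of_bound hf.aestronglyMeasurable C ?_
  filter_upwards [ae_restrict_mem measurableSet_Ioo] with x hx
  exact hC x (Ioo_subset_Icc_self hx)

/-- A cnoidal wave with the right period and levels solves the boundary value problem. -/
lemma cnWave_mem_solutionSet {ε L₁ L w k s : ℝ} {n : ℕ} (hε : ε = 1 ∨ ε = -1) (hL : 0 < L)
    (hw : 0 < w) (hk : k ∈ moduli)
    (hn : Real.sqrt (w / (2 * k ^ 2 - 1)) * L = 4 * ellipticF k (Real.pi / 2) * n) (hn1 : 1 ≤ n)
    (h0 : IsLevel (phi k / 4) (n / L * (0 - s)))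
    (h1 : IsLevel ((1 - ε) / 4 + phi k / 4) (n / L * (L₁ - s))) :
    (-w, (Icc (0 : ℝ) L).domRestrict (cnWave w k s)) ∈ solutionSet ε L₁ L := by
  have hc := continuous_cnWave (w := w) hk s
  have hc' := continuous_cnWaveDeriv hw hk s
  have hc'' : Continuous fun x => w * cnWave w k s x - cnWave w k s x ^ 3 := by fun_prop
  have hper : cnWave w k s 0 = cnWave w k s L := by
    have := cnWave_periodic hk hL hn s n hn1 0
    rw [mul_div_cancel₀ _ (by positivity), zero_add] at this
    exact this.symm
  have hper' : cnWaveDeriv w k s 0 = cnWaveDeriv w k s L := by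
    have := cnWaveDeriv_periodic hk hn s 0
    rw [zero_add] at this
    exact this.symm
  have habs : |(-w)| = w := by rw [abs_neg, abs_of_pos hw]
  refine ⟨neg_lt_zero.2 hw, cnWave w k s, cnWaveDeriv w k s, _,
    ⟨memLp_of_continuous hc L, memLp_of_continuous hc' L, memLp_of_continuous hc'' L,
      hasWeakDeriv_of_hasDerivAt hL (hasDerivAt_cnWave hk s) hc',
      hasWeakDeriv_of_hasDerivAt hL (hasDerivAt_cnWaveDeriv hw hk s) hc'',
      hc.continuousOn, hc'.continuousOn, hper, hper'⟩,
    Filter.Eventually.of_forall fun x => ?_, ?_, ?_, rfl⟩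
  · ring
  · have := (cnWave_eq_level_iff hw hk hL hn (Or.inl rfl) s 0).2 (by simpa using h0)
    simpa [habs] using this
  · simp only [habs]
    exact (cnWave_eq_level_iff hw hk hL hn hε s L₁).2 h1

/-- Every solution of the boundary value problem is a cnoidal wave. -/
lemma exists_cnWave_of_mem_solutionSet {ε L₁ L : ℝ} (hε : ε = 1 ∨ ε = -1) (hL : 0 < L)
    (hL₁ : L₁ ∈ Icc 0 L) {p : ℝ × (Icc (0 : ℝ) L → ℝ)} (hp : p ∈ solutionSet ε L₁ L) :
    ∃ w k s : ℝ, ∃ n : ℕ, 0 < w ∧ k ∈ moduli ∧ 1 ≤ n ∧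
      Real.sqrt (w / (2 * k ^ 2 - 1)) * L = 4 * ellipticF k (Real.pi / 2) * n ∧
      IsLevel (phi k / 4) (n / L * (0 - s)) ∧
      IsLevel ((1 - ε) / 4 + phi k / 4) (n / L * (L₁ - s)) ∧
      p = (-w, (Icc (0 : ℝ) L).domRestrict (cnWave w k s)) := by
  obtain ⟨hω, u, u', u'', hH, hode, hu0, huL₁, hpu⟩ := hp
  obtain ⟨w, hw⟩ : ∃ w, w = -p.1 := ⟨_, rfl⟩
  have hpw : p.1 = -w := by linarith
  have hw0 : 0 < w := by linarith
  rw [hpw, abs_neg, abs_of_pos hw0] at hu0 huL₁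
  -- By the equation u'' agrees almost everywhere with a continuous function, so u' is classically
  -- differentiable.
  have hweak : HasWeakDeriv L u' fun x => w * u x - u x ^ 3 := by
    intro η hη hηc hηs
    rw [hH.weak_snd η hη hηc hηs]
    congr 1
    refine integral_congr_ae ?_
    filter_upwards [hode] with x hx
    rw [hpw] at hx
    rw [show w * u x - u x ^ 3 = u'' x by linarith]
  have hu := hH.weak_fst.hasDerivWithinAt hL hH.cont hH.cont_fst
  have hu' := hweak.hasDerivWithinAt hL hH.cont_fst
    ((continuousOn_const.mul hH.cont).sub (hH.cont.pow 3))
  obtain ⟨k, hk, s, hs, hs'⟩ := exists_cnWave_initial hw0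
    (deriv_ne_zero_of_periodic hw0 hL hu hu' hu0 hH.periodic)
  have h3 := (moduli_bounds hk).2.2.2
  obtain ⟨hEq, hEq'⟩ := eqOn_of_cubic_ode hu hu' (hasDerivAt_cnWave hk s)
    (hasDerivAt_cnWaveDeriv hw0 hk s) (hu0.trans hs.symm) hs'.symm
  have hLmem : L ∈ Icc 0 L := right_mem_Icc.2 hL.le
  have hper : cnWave w k s 0 = cnWave w k s L := by
    rw [hs, ← hEq hLmem, ← hH.periodic, hu0]
  have hper' : cnWaveDeriv w k s 0 = cnWaveDeriv w k s L := by
    rw [hs', ← hEq' hLmem, ← hH.periodic_fst]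
  have hA := amplitude_pos hw0 hk
  have hB := waveNumber_pos hw0 hk
  have hK := ellipticF_pi_div_two_pos h3
  -- Value and slope agree at 0 and L, so L is a whole number of periods, positive since L > 0.
  obtain ⟨m, hm⟩ := eq_add_period_of_jacobiCn_eq h3 (mul_left_cancel₀ hA.ne' hper)
    (mul_right_cancel₀ hB.ne' (mul_left_cancel₀ hA.ne' hper'))
  have hm' : Real.sqrt (w / (2 * k ^ 2 - 1)) * L = 4 * ellipticF k (Real.pi / 2) * m := by
    linarith
  have hmpos : (0 : ℝ) < m := by
    have : 0 < 4 * ellipticF k (Real.pi / 2) * m := hm' ▸ mul_pos hB hL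
    exact pos_of_mul_pos_right this (by positivity)
  have hmpos' : 0 < m := Int.cast_pos.1 hmpos
  obtain ⟨n, rfl⟩ := Int.eq_ofNat_of_zero_le hmpos'.le
  have hn1 : 1 ≤ n := by omega
  rw [Int.cast_natCast] at hm'
  refine ⟨w, k, s, n, hw0, hk, hn1, hm', ?_, ?_, ?_⟩
  · have := (cnWave_eq_level_iff hw0 hk hL hm' (Or.inl rfl) s 0).1 (by rw [one_mul, hs])
    simpa using this
  · refine (cnWave_eq_level_iff hw0 hk hL hm' hε s L₁).1 ?_
    rw [← hEq hL₁, huL₁]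
  · exact Prod.ext hpw (hpu.trans (domRestrict_eq_domRestrict_iff.2 hEq))

/-! ### Assembling the solution set -/

/-- The frequency `-(n G(y) / L)²`. -/
noncomputable def frequency (L y : ℝ) (n : ℕ) : ℝ :=
  -(n / L * G y) ^ 2

section
variable {L y : ℝ} {n : ℕ}

lemma frequency_iff (hL : 0 < L) (hy : y ∈ Ioo 0 1) (hn : 1 ≤ n) (ω : ℝ) :
    (ω < 0 ∧ Real.sqrt |ω| = n / L * G y) ↔ ω = frequency L y n := by
  have hG := G_pos hy
  have hn : (0 : ℝ) < n := by exact_mod_cast hn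
  have hpos : 0 < n / L * G y := by positivity
  rw [frequency]
  constructor
  · rintro ⟨hω, h⟩
    rw [← h, Real.sq_sqrt (abs_nonneg _), abs_of_neg hω, neg_neg]
  · rintro rfl
    refine ⟨neg_lt_zero.2 (by positivity), ?_⟩
    rw [abs_neg, abs_of_pos (by positivity), Real.sqrt_sq hpos.le]

/-- The modulus is recovered from the frequency: S(φ⁻¹(y)) = G(y) = L√|ω|/n, so S⁻¹ returns φ⁻¹(y).
-/
lemma profile_frequency (hL : 0 < L) (hy : y ∈ Ioo 0 1) (hn : 1 ≤ n) (s : ℝ) :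
    profile L (frequency L y n) n s = cnWave (-frequency L y n) (phiInv y) s ∧
      0 < -frequency L y n ∧
      Real.sqrt (-frequency L y n / (2 * phiInv y ^ 2 - 1)) * L =
        4 * ellipticF (phiInv y) (Real.pi / 2) * n := by
  obtain ⟨hneg, hsqrt⟩ := (frequency_iff hL hy hn _).2 rfl
  have hn0 : (n : ℝ) ≠ 0 := by positivity
  have hS : S (phiInv y) = L * (Real.sqrt |frequency L y n| / n) := by
    rw [hsqrt, G]; field_simp
  have hmod : modulus L (frequency L y n) n = phiInv y := by
    rw [modulus, ← hS, SInv_S (phiInv_mem hy)]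
  have hw := neg_pos.2 hneg
  rw [abs_of_neg hneg] at hS
  refine ⟨?_, hw, (waveNumber_mul_eq_iff (phiInv_mem hy) hw hn).2 hS⟩
  rw [profile_eq_cnWave, hmod, abs_of_neg hneg]

end

section
variable {ε L₁ L : ℝ} {y s : ℕ → ℝ}

/-- The solutions, given the moduli and shifts selected by the level conditions. -/
lemma solutionSet_eq (hε : ε = 1 ∨ ε = -1) (hL : 0 < L) (hL₁ : L₁ ∈ Icc 0 L)
    (hy : ∀ n, 1 ≤ n → y n ∈ Ioo 0 1)
    (hlevel : ∀ n : ℕ, 1 ≤ n → ∀ φ ∈ Ioo (0 : ℝ) 1, ∀ t : ℝ,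
      (IsLevel (φ / 4) (n / L * (0 - t)) ∧
        IsLevel ((1 - ε) / 4 + φ / 4) (n / L * (L₁ - t))) ↔
      φ = y n ∧ ∃ m : ℤ, n / L * (t - s n) = m) :
    solutionSet ε L₁ L = {p | ∃ n : ℕ, 1 ≤ n ∧ p = (frequency L (y n) n,
      (Icc (0 : ℝ) L).domRestrict (profile L (frequency L (y n) n) n (s n)))} := by
  ext p
  constructor
  · intro hp
    obtain ⟨w, k, t, n, hw, hk, hn1, hn, h0, h1, rfl⟩ :=
      exists_cnWave_of_mem_solutionSet hε hL hL₁ hp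
    obtain ⟨hφ, m, hm⟩ := (hlevel n hn1 (phi k) (phi_mem_Ioo hk) t).1 ⟨h0, h1⟩
    have hky : phiInv (y n) = k := by rw [← hφ, phiInv_phi hk]
    have hn0 : (n : ℝ) ≠ 0 := by positivity
    have hfreq : -w = frequency L (y n) n := by
      refine (frequency_iff hL (hy n hn1) hn1 _).1 ⟨neg_lt_zero.2 hw, ?_⟩
      rw [G, hky, (waveNumber_mul_eq_iff hk hw hn1).1 hn, abs_neg, abs_of_pos hw]
      field_simp
    refine ⟨n, hn1, ?_⟩
    rw [(profile_frequency hL (hy n hn1) hn1 (s n)).1, ← hfreq, neg_neg, hky,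
      cnWave_shift hk hL hn hm]
  · rintro ⟨n, hn1, rfl⟩
    obtain ⟨hprof, hw, hn⟩ := profile_frequency hL (hy n hn1) hn1 (s n)
    obtain ⟨h0, h1⟩ := (hlevel n hn1 (y n) (hy n hn1) (s n)).2 ⟨rfl, 0, by simp⟩
    rw [← phi_phiInv (hy n hn1)] at h0 h1
    have := cnWave_mem_solutionSet hε hL hw (phiInv_mem (hy n hn1)) hn hn1 h0 h1
    rwa [neg_neg, ← hprof] at this

lemma isLeast_period_profile (hL : 0 < L) (hy : ∀ n, 1 ≤ n → y n ∈ Ioo 0 1) (n : ℕ)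
    (hn1 : 1 ≤ n) : IsLeast {T : ℝ | 0 < T ∧ Function.Periodic
      (profile L (frequency L (y n) n) n (s n)) T} (L / n) := by
  obtain ⟨hprof, hw, hn⟩ := profile_frequency hL (hy n hn1) hn1 (s n)
  rw [hprof]
  exact isLeast_period_cnWave hw (phiInv_mem (hy n hn1)) hL hn hn1 (s n)

lemma periodic_profile (hL : 0 < L) (hy : ∀ n, 1 ≤ n → y n ∈ Ioo 0 1) (n : ℕ)
    (hn1 : 1 ≤ n) : Function.Periodic (profile L (frequency L (y n) n) n (s n)) L := by
  obtain ⟨hprof, hw, hn⟩ := profile_frequency hL (hy n hn1) hn1 (s n)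
  have := cnWave_periodic (phiInv_mem (hy n hn1)) hL hn (s n) n hn1
  rwa [mul_div_cancel₀ _ (by positivity), ← hprof] at this

lemma eq_of_periodic_of_eqOn {f g : ℝ → ℝ} (hL : 0 < L) (hf : Function.Periodic f L)
    (hg : Function.Periodic g L) (h : EqOn f g (Icc 0 L)) : f = g := by
  funext x
  rw [← hf.sub_zsmul_eq (toIcoDiv hL 0 x), ← hg.sub_zsmul_eq (toIcoDiv hL 0 x)]
  have := toIcoMod_mem_Ico hL 0 x
  rw [zero_add] at this
  exact h (Ico_subset_Icc_self this)

/-- A function of period L is determined by its restriction to [0, L], so equal solutions have equal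
minimal periods L/n and equal n. -/
lemma countable_and_infinite_solutions (hL : 0 < L) (hy : ∀ n, 1 ≤ n → y n ∈ Ioo 0 1) :
    {p | ∃ n : ℕ, 1 ≤ n ∧ p = (frequency L (y n) n,
      (Icc (0 : ℝ) L).domRestrict (profile L (frequency L (y n) n) n (s n)))}.Countable ∧
    {p | ∃ n : ℕ, 1 ≤ n ∧ p = (frequency L (y n) n,
      (Icc (0 : ℝ) L).domRestrict (profile L (frequency L (y n) n) n (s n)))}.Infinite := by
  constructor
  · refine (countable_range fun n : ℕ => (frequency L (y n) n, (Icc (0 : ℝ) L).domRestrict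
      (profile L (frequency L (y n) n) n (s n)))).mono ?_
    rintro p ⟨n, _, rfl⟩
    exact ⟨n, rfl⟩
  · refine infinite_of_injective_forall_mem (f := fun n : ℕ => (frequency L (y (n + 1)) (n + 1),
      (Icc (0 : ℝ) L).domRestrict
        (profile L (frequency L (y (n + 1)) (n + 1)) (n + 1) (s (n + 1))))) ?_
      fun n => ⟨n + 1, by omega, rfl⟩
    intro a b hab
    have hfun := eq_of_periodic_of_eqOn hL (periodic_profile (s := s) hL hy (a + 1) (by omega))
      (periodic_profile (s := s) hL hy (b + 1) (by omega))
      (domRestrict_eq_domRestrict_iff.1 (congrArg Prod.snd hab))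
    have ha := isLeast_period_profile (s := s) hL hy (a + 1) (by omega)
    have hb := isLeast_period_profile (s := s) hL hy (b + 1) (by omega)
    rw [hfun] at ha
    have h := ha.unique hb
    rw [div_eq_div_iff (by positivity) (by positivity), mul_right_inj' hL.ne'] at h
    push_cast at h
    exact_mod_cast (add_right_cancel h).symm

end

/-! ### Arithmetic of the level conditions -/

section
variable {L₁ L : ℝ} {n : ℕ}

/-- Excluding integers and half-integers keeps r_n away from 0 and −1/2, and rules out equal signs
in the level conditions. -/
lemma mul_natCast_ne_half_int (hirr : Irrational (L₁ / L)) (hn : 1 ≤ n) (m : ℤ) :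
    L₁ / L * n ≠ m / 2 := by
  intro h
  refine (hirr.mul_natCast (by omega : n ≠ 0)) ⟨(m : ℚ) / 2, ?_⟩
  rw [h]
  push_cast
  ring

lemma r_eq {m : ℤ} {x : ℝ} (h : L₁ / L * n = m + x) (hx : x ∈ Ico (-(1 / 2)) (1 / 2)) :
    r L₁ L n = x := by
  have : ⌊L₁ / L * n + 1 / 2⌋ = m := by
    rw [Int.floor_eq_iff]
    constructor <;> linarith [hx.1, hx.2]
  rw [r, this]
  linarith

lemma exists_eq_add_r : ∃ m : ℤ, L₁ / L * n = m + r L₁ L n :=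
  ⟨⌊L₁ / L * n + 1 / 2⌋, by rw [r]; ring⟩

lemma abs_r_mem (hirr : Irrational (L₁ / L)) (hn : 1 ≤ n) :
    |r L₁ L n| ∈ Ioo (0 : ℝ) (1 / 2) := by
  have h₁ := Int.floor_le (L₁ / L * n + 1 / 2)
  have h₂ := Int.lt_floor_add_one (L₁ / L * n + 1 / 2)
  refine ⟨abs_pos.2 fun h => ?_, abs_lt.2 ⟨lt_of_le_of_ne ?_ fun h => ?_, ?_⟩⟩
  · obtain ⟨m, hm⟩ := exists_eq_add_r (L₁ := L₁) (L := L) (n := n)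
    refine mul_natCast_ne_half_int hirr hn (2 * m) ?_
    rw [hm, h]
    push_cast
    ring
  · rw [r]; linarith
  · obtain ⟨m, hm⟩ := exists_eq_add_r (L₁ := L₁) (L := L) (n := n)
    refine mul_natCast_ne_half_int hirr hn (2 * m - 1) ?_
    rw [hm, ← h]
    push_cast
    ring
  · rw [r]; linarith

lemma xi_mem (hirr : Irrational (L₁ / L)) (hn : 1 ≤ n) : xi L₁ L n ∈ Ioo (0 : ℝ) 1 := by
  have := abs_r_mem hirr hn
  rw [xi]
  constructor <;> linarith [this.1, this.2]

lemma div_mul_sPlus (hL : 0 < L) (hn : 1 ≤ n) : n / L * sPlus L₁ L n = r L₁ L n / 2 := by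
  have : (n : ℝ) ≠ 0 := by positivity
  rw [sPlus]
  field_simp

lemma div_mul_sMinus (hL : 0 < L) (hn : 1 ≤ n) :
    n / L * sMinus L₁ L n = (|r L₁ L n| - 1 / 2) * Real.sign (r L₁ L n) / 2 := by
  have : (n : ℝ) ≠ 0 := by positivity
  rw [sMinus]
  field_simp

/-- Subtracting the two congruences, equal signs make n L₁/L an integer. Opposite signs give n L₁/L
≡ ±φ/2 with φ/2 < 1/2, so r_n = ±φ/2, and its sign tells which crossing lies at 0. The unsimplified
(1 - 1) is the general (1 − ε)/4 at ε = 1. -/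
lemma level_iff_plus (hL : 0 < L) (hirr : Irrational (L₁ / L)) (hn : 1 ≤ n) {φ : ℝ}
    (hφ : φ ∈ Ioo (0 : ℝ) 1) (t : ℝ) :
    (IsLevel (φ / 4) (n / L * (0 - t)) ∧
      IsLevel ((1 - 1) / 4 + φ / 4) (n / L * (L₁ - t))) ↔
    φ = xi L₁ L n ∧ ∃ m : ℤ, n / L * (t - sPlus L₁ L n) = m := by
  have hα : n / L * (L₁ - t) = L₁ / L * n + n / L * (0 - t) := by ring
  have hs := div_mul_sPlus (L₁ := L₁) hL hn
  rw [hα, xi, mul_sub _ t, hs, show n / L * (0 - t) = -(n / L * t) by ring]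
  set z := n / L * t
  set α := L₁ / L * n with hαdef
  constructor
  · rintro ⟨⟨m₀, h₀⟩, ⟨m₁, h₁⟩⟩
    have hne := mul_natCast_ne_half_int hirr hn (2 * (m₁ - m₀))
    push_cast at hne
    rcases h₀ with h₀ | h₀ <;> rcases h₁ with h₁ | h₁
    · exact absurd (by linarith) hne
    · have hr : r L₁ L n = -(φ / 2) := r_eq (m := m₁ - m₀) (by push_cast; linarith)
        ⟨by linarith [hφ.2], by linarith [hφ.1]⟩
      refine ⟨by rw [hr, abs_neg, abs_of_pos (by linarith [hφ.1])]; ring, -m₀, ?_⟩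
      rw [hr]; push_cast; linarith
    · have hr : r L₁ L n = φ / 2 := r_eq (m := m₁ - m₀) (by push_cast; linarith)
        ⟨by linarith [hφ.1], by linarith [hφ.2]⟩
      refine ⟨by rw [hr, abs_of_pos (by linarith [hφ.1])]; ring, -m₀, ?_⟩
      rw [hr]; push_cast; linarith
    · exact absurd (by linarith) hne
  · rintro ⟨rfl, m, hm⟩
    obtain ⟨N, hN⟩ := exists_eq_add_r (L₁ := L₁) (L := L) (n := n)
    rw [← hαdef] at hN
    rcases abs_cases (r L₁ L n) with ⟨h, _⟩ | ⟨h, _⟩ <;> rw [h]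
    · exact ⟨⟨-m, Or.inr (by push_cast; linarith)⟩, ⟨N - m, Or.inl (by push_cast; linarith)⟩⟩
    · exact ⟨⟨-m, Or.inl (by push_cast; linarith)⟩, ⟨N - m, Or.inr (by push_cast; linarith)⟩⟩

/-- Equal signs now make n L₁/L a half-integer. Opposite signs give ±(1/2 + φ/2), which modulo 1 is
∓(1 − φ)/2, hence the value 1 − ξ_n and the extra integer ±1 in the witnesses. -/
lemma level_iff_minus (hL : 0 < L) (hirr : Irrational (L₁ / L)) (hn : 1 ≤ n) {φ : ℝ}
    (hφ : φ ∈ Ioo (0 : ℝ) 1) (t : ℝ) :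
    (IsLevel (φ / 4) (n / L * (0 - t)) ∧
      IsLevel ((1 - -1) / 4 + φ / 4) (n / L * (L₁ - t))) ↔
    φ = 1 - xi L₁ L n ∧ ∃ m : ℤ, n / L * (t - sMinus L₁ L n) = m := by
  have hα : n / L * (L₁ - t) = L₁ / L * n + n / L * (0 - t) := by ring
  have hs := div_mul_sMinus (L₁ := L₁) hL hn
  rw [hα, xi, mul_sub _ t, hs, show n / L * (0 - t) = -(n / L * t) by ring]
  set z := n / L * t
  set α := L₁ / L * n with hαdef
  constructor
  · rintro ⟨⟨m₀, h₀⟩, ⟨m₁, h₁⟩⟩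
    have hne := mul_natCast_ne_half_int hirr hn (2 * (m₁ - m₀) + 1)
    have hne' := mul_natCast_ne_half_int hirr hn (2 * (m₁ - m₀) - 1)
    push_cast at hne hne'
    rcases h₀ with h₀ | h₀ <;> rcases h₁ with h₁ | h₁
    · exact absurd (by linarith) hne
    · have hr : r L₁ L n = (1 - φ) / 2 := r_eq (m := m₁ - m₀ - 1) (by push_cast; linarith)
        ⟨by linarith [hφ.2], by linarith [hφ.1]⟩
      have hr0 : 0 < r L₁ L n := by linarith [hφ.2]
      refine ⟨by rw [abs_of_pos hr0, hr]; ring, -m₀, ?_⟩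
      rw [abs_of_pos hr0, Real.sign_of_pos hr0, hr]; push_cast; linarith
    · have hr : r L₁ L n = -((1 - φ) / 2) := r_eq (m := m₁ - m₀ + 1) (by push_cast; linarith)
        ⟨by linarith [hφ.1], by linarith [hφ.2]⟩
      have hr0 : r L₁ L n < 0 := by linarith [hφ.2]
      refine ⟨by rw [abs_of_neg hr0, hr]; ring, -m₀, ?_⟩
      rw [abs_of_neg hr0, Real.sign_of_neg hr0, hr]; push_cast; linarith
    · exact absurd (by linarith) hne'
  · rintro ⟨rfl, m, hm⟩
    obtain ⟨N, hN⟩ := exists_eq_add_r (L₁ := L₁) (L := L) (n := n)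
    rw [← hαdef] at hN
    rcases (abs_pos.1 (abs_r_mem hirr hn).1).lt_or_gt with hr | hr
    · rw [abs_of_neg hr, Real.sign_of_neg hr] at *
      exact ⟨⟨-m, Or.inr (by push_cast; linarith)⟩,
        ⟨N - m - 1, Or.inl (by push_cast; linarith)⟩⟩
    · rw [abs_of_pos hr, Real.sign_of_pos hr] at *
      exact ⟨⟨-m, Or.inl (by push_cast; linarith)⟩,
        ⟨N - m + 1, Or.inr (by push_cast; linarith)⟩⟩

end

end DoubleBridge

theorem theorem1 (L₁ L₂ L : ℝ) (hL₁ : 0 < L₁) (hL₂ : L₁ ≤ L₂) (hL : L = L₁ + L₂)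
    (hirr : Irrational (L₁ / L)) :
    -- the inverse functions of `S` and `φ` exist, and `G` is evaluated in its domain
    Set.BijOn DoubleBridge.S DoubleBridge.moduli (Set.Ioi 0) ∧
    Set.BijOn DoubleBridge.phi DoubleBridge.moduli (Set.Ioo 0 1) ∧
    (∀ n : ℕ, 1 ≤ n → DoubleBridge.xi L₁ L n ∈ Set.Ioo (0 : ℝ) 1) ∧
    ∃ ωp ωm : ℕ → ℝ,
      -- the frequencies
      (∀ n : ℕ, 1 ≤ n → ∀ ω : ℝ,
        (ω < 0 ∧ Real.sqrt |ω| = n / L * DoubleBridge.G (DoubleBridge.xi L₁ L n)) ↔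
          ω = ωp n) ∧
      (∀ n : ℕ, 1 ≤ n → ∀ ω : ℝ,
        (ω < 0 ∧ Real.sqrt |ω| = n / L * DoubleBridge.G (1 - DoubleBridge.xi L₁ L n)) ↔
          ω = ωm n) ∧
      -- the solutions
      DoubleBridge.solutionSet 1 L₁ L =
        {p | ∃ n : ℕ, 1 ≤ n ∧ p = (ωp n, (Set.Icc (0 : ℝ) L).domRestrict
          (DoubleBridge.profile L (ωp n) n (DoubleBridge.sPlus L₁ L n)))} ∧
      DoubleBridge.solutionSet (-1) L₁ L =
        {p | ∃ n : ℕ, 1 ≤ n ∧ p = (ωm n, (Set.Icc (0 : ℝ) L).domRestrict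
          (DoubleBridge.profile L (ωm n) n (DoubleBridge.sMinus L₁ L n)))} ∧
      -- they form countable, and not finite, families
      ((DoubleBridge.solutionSet 1 L₁ L).Countable ∧
        (DoubleBridge.solutionSet 1 L₁ L).Infinite) ∧
      ((DoubleBridge.solutionSet (-1) L₁ L).Countable ∧
        (DoubleBridge.solutionSet (-1) L₁ L).Infinite) ∧
      -- the least positive period of the `n`-th solution is `L / n`
      (∀ n : ℕ, 1 ≤ n → IsLeast {T : ℝ | 0 < T ∧ Function.Periodic
        (DoubleBridge.profile L (ωp n) n (DoubleBridge.sPlus L₁ L n)) T} (L / n)) ∧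
      (∀ n : ℕ, 1 ≤ n → IsLeast {T : ℝ | 0 < T ∧ Function.Periodic
        (DoubleBridge.profile L (ωm n) n (DoubleBridge.sMinus L₁ L n)) T} (L / n)) := by

  have hL0 : 0 < L := by linarith
  have hL₁mem : L₁ ∈ Icc 0 L := ⟨hL₁.le, by linarith⟩
  have hxi : ∀ n : ℕ, 1 ≤ n → DoubleBridge.xi L₁ L n ∈ Ioo (0 : ℝ) 1 := fun n hn =>
    DoubleBridge.xi_mem hirr hn
  have hxi' : ∀ n : ℕ, 1 ≤ n → 1 - DoubleBridge.xi L₁ L n ∈ Ioo (0 : ℝ) 1 := fun n hn =>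
    ⟨by linarith [(hxi n hn).2], by linarith [(hxi n hn).1]⟩
  have hplus := DoubleBridge.solutionSet_eq (s := DoubleBridge.sPlus L₁ L) (Or.inl rfl) hL0
    hL₁mem hxi fun n hn φ hφ t => DoubleBridge.level_iff_plus hL0 hirr hn hφ t
  have hminus := DoubleBridge.solutionSet_eq (s := DoubleBridge.sMinus L₁ L) (Or.inr rfl) hL0
    hL₁mem hxi' fun n hn φ hφ t => DoubleBridge.level_iff_minus hL0 hirr hn hφ t
  refine ⟨DoubleBridge.bijOn_S, DoubleBridge.bijOn_phi, hxi,
    fun n => DoubleBridge.frequency L (DoubleBridge.xi L₁ L n) n,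
    fun n => DoubleBridge.frequency L (1 - DoubleBridge.xi L₁ L n) n,
    fun n hn => DoubleBridge.frequency_iff hL0 (hxi n hn) hn,
    fun n hn => DoubleBridge.frequency_iff hL0 (hxi' n hn) hn, hplus, hminus, ?_, ?_,
    DoubleBridge.isLeast_period_profile hL0 hxi, DoubleBridge.isLeast_period_profile hL0 hxi'⟩
  · rw [hplus]
    exact DoubleBridge.countable_and_infinite_solutions hL0 hxi
  · rw [hminus]
    exact DoubleBridge.countable_and_infinite_solutions hL0 hxi'
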